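/- **Setting.** Let $d\ge 1$ and $N$ be integers. $|E|$ denotes the Lebesgue measure of a Lebesgue measurable set $E\subset\mathbb R^d$, $B_1(x)$ the open unit ball centred at $x$, and $E\triangle F$ the symmetric difference. The perimeter of $E$ in an open set $U\subset\mathbb R^d$ is the total variation on $U$ of the distributional derivative of the characteristic function $1_E$, $$\mathrm{Per}(E,U)=|D1_E|(U)=\sup\Big\{\int_E \mathrm{div}\,X\,dx : X\in C^1_c(U;\mathbb R^d),\ |X|\le 1\Big\}\in[0,+\infty],$$ and $\mathrm{Per}(E):=\mathrm{Per}(E,\mathbb R^d)$. An $N$-partition of $\mathbb R^d$ is an $N$-tuple $\vec E=(E_1,\dots,E_N)$ of measurable sets with $|E_j\cap E_k|=0$ for $j\ne k$ and $|\mathbb R^d\setminus\bigcup_{j}E_j|=0$; empty or null regions are allowed. We put $\mathrm{Per}(\vec E,U):=\frac12\sum_{j=1}^N\mathrm{Per}(E_j,U)$ and $\vec E-x:=(E_1-x,\dots,E_N-x)$, where $E_j-x=\{y-x: y\in E_j\}$. A sequence $\vec G_n$ of $N$-partitions converges to an $N$-partition $\vec F$ in $L^1_{\mathrm{loc}}(\mathbb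 R^d)$ if $|(G^n_j\triangle F_j)\cap B|\to0$ as $n\to\infty$ for every bounded measurable $B\subset\mathbb R^d$ and every $j=1,\dots,N$. **Theorem 3.1.** Let $\vec E_n=(E^n_1,\dots,E^n_N)$, $n\in\mathbb N$, be a sequence of $N$-partitions of $\mathbb R^d$, and let $$m_j:=\limsup_{n\to\infty}|E^n_j|\in[0,+\infty],\qquad j=1,\dots,N.$$ Assume that $$\sup_{x\in\mathbb R^d}\ \sup_{n\in\mathbb N}\mathrm{Per}(\vec E_n,B_1(x))<+\infty$$ and that, for every $j$, $$m_j<+\infty\ \Longrightarrow\ \sup_{n\in\mathbb N}\mathrm{Per}(E^n_j)<+\infty .$$ Then there exist a strictly increasing sequence of indices $(n_k)_{k\in\mathbb N}$, $N$-partitions $\vec F^i=(F^i_1,\dots,F^i_N)$ of $\mathbb R^d$ for $i\in\mathbb N$, and points $x^i_k\in\mathbb R^d$ for $i,k\in\mathbb N$, such that 1. $\displaystyle\lim_{k\to\infty}|x^i_k-x^{i'}_k|=+\infty$ whenever $i\ne i'$; 2. for each $i\in\mathbb N$, $\vec E_{n_k}-x^i_k\to\vec F^i$ in $L^1_{\mathrm{loc}}(\mathbb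 R^d)$ as $k\to\infty$; 3. for every $j$ with $m_j<+\infty$, the limit $\displaystyle\lim_{k\to\infty}|E^{n_k}_j|$ exists and $$\sum_{i\in\mathbb N}|F^i_j|=\lim_{k\to\infty}|E^{n_k}_j| .$$ -/

import Mathlib

open MeasureTheory Filter Topology
open scoped ENNReal

namespace PartitionCompactness

/-- Euclidean space `ℝ^d`. -/
abbrev Space (d : ℕ) : Type := EuclideanSpace ℝ (Fin d)

/-- The divergence `∑ₖ ∂ₖ Xₖ` of a vector field on `ℝ^d`. -/
noncomputable def divergence {d : ℕ} (X : Space d → Space d) (x : Space d) : ℝ :=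
  ∑ k : Fin d, (fderiv ℝ X x (EuclideanSpace.single k 1)) k

/-- Admissible test fields for the total variation on an open set `U`:
the fields of class `C¹` with compact support contained in `U`
and Euclidean norm at most `1` everywhere. -/
structure IsTestField {d : ℕ} (U : Set (Space d)) (X : Space d → Space d) : Prop where
  contDiff : ContDiff ℝ 1 X
  hasCompactSupport : HasCompactSupport X
  tsupport_subset : tsupport X ⊆ U
  norm_le_one : ∀ x, ‖X x‖ ≤ 1

/-- The total variation on the open set `U` of the distributional derivative of the
characteristic function of `E`: the supremum of `∫_E div X` over the test fields `X` in `U`. -/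
noncomputable def openVariation {d : ℕ} (E U : Set (Space d)) : ℝ≥0∞ :=
  ⨆ (X : Space d → Space d) (_ : IsTestField U X),
    ENNReal.ofReal (∫ x in E, divergence X x)

/-- The perimeter `Per(E, B) = |D 1_E|(B)` of `E` in `B`: the value on open sets is the
total variation, and it is extended to all sets by outer regularity. -/
noncomputable def perimeter {d : ℕ} (E B : Set (Space d)) : ℝ≥0∞ :=
  ⨅ (U : Set (Space d)) (_ : IsOpen U) (_ : B ⊆ U), openVariation E U

theorem openVariation_mono {d : ℕ} (E : Set (Space d)) {U V : Set (Space d)} (h : U ⊆ V) :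
    openVariation E U ≤ openVariation E V :=
  iSup_mono fun _ => iSup_mono' fun hX =>
    ⟨⟨hX.contDiff, hX.hasCompactSupport, hX.tsupport_subset.trans h, hX.norm_le_one⟩, le_rfl⟩

/-- On open sets the perimeter is the total variation. -/
theorem perimeter_of_isOpen {d : ℕ} (E : Set (Space d)) {U : Set (Space d)} (hU : IsOpen U) :
    perimeter E U = openVariation E U :=
  le_antisymm (iInf_le_of_le U (iInf_le_of_le hU (iInf_le_of_le subset_rfl le_rfl)))
    (le_iInf fun _ => le_iInf fun _ => le_iInf fun h => openVariation_mono E h)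

/-- `N`-partitions of `ℝ^d`: Lebesgue measurable regions which are pairwise disjoint and cover
the space, both up to Lebesgue null sets. -/
structure IsPartition {d N : ℕ} (E : Fin N → Set (Space d)) : Prop where
  measurable : ∀ j, NullMeasurableSet (E j) volume
  inter_null : ∀ j k, j ≠ k → volume (E j ∩ E k) = 0
  cover : volume (⋃ j, E j)ᶜ = 0

/-- `Per(E, B) = (1/2) ∑ⱼ Per(Eⱼ, B)` for an `N`-tuple `E` of sets. -/
noncomputable def partitionPerimeter {d N : ℕ} (E : Fin N → Set (Space d))
    (B : Set (Space d)) : ℝ≥0∞ :=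
  (∑ j, perimeter (E j) B) / 2

/-- The translated tuple `E - v`, that is `Eⱼ - v = {y - v : y ∈ Eⱼ}` for each `j`. -/
def translateSub {d N : ℕ} (E : Fin N → Set (Space d)) (v : Space d) :
    Fin N → Set (Space d) :=
  fun j => (fun y => y - v) '' E j

/-- Convergence in `L¹_loc` of a sequence of `N`-tuples of sets. -/
def TendstoL1Loc {d N : ℕ} (E : ℕ → Fin N → Set (Space d)) (F : Fin N → Set (Space d)) :
    Prop :=
  ∀ B : Set (Space d), NullMeasurableSet B volume → Bornology.IsBounded B →
    ∀ j, Tendsto (fun n => volume (symmDiff (E n j) (F j) ∩ B)) atTop (𝓝 0)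

end PartitionCompactness

namespace PartitionCompactness

open Set Metric
open scoped Convolution

/-! This is a concentration-compactness argument in which perimeter enters only through
translations: `volume_ball_inter_shiftDiff_le` bounds the measure of the points whose membership in
`E` changes under a shift by `h` by `‖h‖` times the perimeter.

Compactness. A locally uniform shift bound makes a set close, in measure, to its averages over balls
of radius `r`, with an error linear in `r`. If these averages converge for a sequence of radii
tending to 0, the sets are locally Cauchy in measure (`tendsto_volume_symmDiff_inter_ball`), and
`exists_limit_of_tendsto_symmDiff` provides a limit set. Convergence of countably many averages
suffices, so one extraction serves countably many moving frames (`exists_subseq_frames`).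

No loss of mass. Let `A` be the union of the regions with finite `m j`. Unit balls are chosen
greedily so that no unit ball retains more than `2|A|/i` of the mass of `A` outside the first `i` of
them (`exists_greedy_centers`). Away from the doubled balls, every region in `A` then has density at
most 1/2 at a small scale `r`, and by the shift bound such a part has measure `O(r)`. This replaces
an isoperimetric inequality and gives tightness uniformly in `n`
(`exists_eventually_volume_diff_balls_le`).

Splitting. After extraction, frames at finite limiting distance see translates of the same picture,
so one representative per class is kept. Balls around different representatives are eventually
disjoint, which gives `∑ ≤ liminf` (`sum_volume_le_liminf`); tightness gives `limsup ≤ ∑`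
(`limsup_volume_le_tsum`). Artificial diverging frames ensure that there are infinitely many
classes. -/

/-! ### Perimeter controls translations -/

/-- The average of `f` over the segment from `x - h` to `x`. -/
noncomputable def segmentAverage {d : ℕ} (f : Space d → ℝ) (h x : Space d) : ℝ :=
  ∫ t in (0 : ℝ)..1, f (x - t • h)

/-- The average is the convolution of `f` with a finite measure, the image of Lebesgue measure on
`(0, 1]` under `t ↦ t • h`, so it inherits the regularity of `f`. -/
theorem contDiff_segmentAverage {d : ℕ} {f : Space d → ℝ} (hf : ContDiff ℝ 1 f)
    (hc : HasCompactSupport f) (h : Space d) : ContDiff ℝ 1 (segmentAverage f h) := by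
  let ν : Measure (Space d) :=
    Measure.map (fun t : ℝ => t • h) (volume.restrict (Ioc (0 : ℝ) 1))
  have hm : Measurable (fun t : ℝ => t • h) := by fun_prop
  have : IsFiniteMeasure ν := by
    constructor
    rw [Measure.map_apply hm MeasurableSet.univ]
    simp
  have h1 : ContDiff ℝ 1 ((fun _ : Space d => (1 : ℝ)) ⋆[ContinuousLinearMap.lsmul ℝ ℝ, ν] f) :=
    hc.contDiff_convolution_right _ (locallyIntegrable_const _) hf
  convert h1 using 1
  ext x
  rw [segmentAverage, intervalIntegral.integral_of_le zero_le_one, convolution_def]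
  rw [integral_map hm.aemeasurable]
  · simp
  · have := hf.continuous
    exact Continuous.aestronglyMeasurable (by simp; fun_prop)

theorem abs_segmentAverage_le {d : ℕ} {f : Space d → ℝ} (hf : ∀ x, |f x| ≤ 1)
    (h x : Space d) : |segmentAverage f h x| ≤ 1 := by
  have := intervalIntegral.norm_integral_le_of_norm_le_const (a := 0) (b := 1) (C := 1)
    (f := fun t : ℝ => f (x - t • h)) (fun t _ => hf _)
  simpa [segmentAverage] using this

theorem tsupport_segmentAverage_subset {d : ℕ} {f : Space d → ℝ} {x₀ : Space d} {R : ℝ}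
    (hf : tsupport f ⊆ closedBall x₀ R) (h : Space d) :
    tsupport (segmentAverage f h) ⊆ closedBall x₀ (R + ‖h‖) := by
  refine closure_minimal ?_ isClosed_closedBall
  intro x hx
  by_contra hcon
  apply hx
  rw [segmentAverage]
  rw [intervalIntegral.integral_congr (g := fun _ => (0 : ℝ)), intervalIntegral.integral_zero]
  intro t ht
  rw [uIcc_of_le zero_le_one] at ht
  apply image_eq_zero_of_notMem_tsupport
  intro hmem
  apply hcon
  have h1 := hf hmem
  rw [mem_closedBall, dist_eq_norm] at h1 ⊢
  calc ‖x - x₀‖ = ‖(x - t • h - x₀) + t • h‖ := by congr 1; abel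
    _ ≤ ‖x - t • h - x₀‖ + ‖t • h‖ := norm_add_le _ _
    _ ≤ R + ‖h‖ := by
      refine add_le_add h1 ?_
      rw [norm_smul, Real.norm_eq_abs, abs_of_nonneg ht.1]
      exact mul_le_of_le_one_left (norm_nonneg _) ht.2

theorem fderiv_segmentAverage {d : ℕ} {f : Space d → ℝ} (hf : ContDiff ℝ 1 f)
    (hc : HasCompactSupport f) (h x : Space d) :
    fderiv ℝ (segmentAverage f h) x h = f x - f (x - h) := by
  have hd : DifferentiableAt ℝ (segmentAverage f h) x :=
    (contDiff_segmentAverage hf hc h).differentiable one_ne_zero x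
  have hcont : Continuous (fun u : ℝ => f (x + u • h)) := by
    have := hf.continuous
    fun_prop
  have h1 : HasDerivAt (fun s : ℝ => segmentAverage f h (x + s • h))
      (fderiv ℝ (segmentAverage f h) x h) 0 := by
    have hd' : HasFDerivAt (segmentAverage f h) (fderiv ℝ (segmentAverage f h) x)
        (x + (0 : ℝ) • h) := by simpa using hd.hasFDerivAt
    have hl : HasDerivAt (fun s : ℝ => x + s • h) h 0 := by
      simpa using ((hasDerivAt_id (0 : ℝ)).smul_const h).const_add x
    exact hd'.comp_hasDerivAt (0 : ℝ) hl
  -- Moving the base point along `h` only slides the integration window to `[s - 1, s]`, so the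
  -- fundamental theorem of calculus yields the difference of the end values.
  have heq : (fun s : ℝ => segmentAverage f h (x + s • h)) =
      fun s : ℝ => (∫ u in (0 : ℝ)..s, f (x + u • h)) - ∫ u in (0 : ℝ)..(s - 1), f (x + u • h) := by
    ext s
    rw [segmentAverage, intervalIntegral.integral_interval_sub_left
      (hcont.intervalIntegrable _ _) (hcont.intervalIntegrable _ _)]
    have := intervalIntegral.integral_comp_sub_left (a := 0) (b := 1)
      (fun u : ℝ => f (x + u • h)) s
    simp only [sub_zero] at this
    rw [← this]
    congr 1
    ext t
    congr 1
    rw [sub_smul]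
    abel
  have h2 : HasDerivAt (fun s : ℝ => (∫ u in (0 : ℝ)..s, f (x + u • h)) -
      ∫ u in (0 : ℝ)..(s - 1), f (x + u • h)) (f x - f (x - h)) 0 := by
    have ha : HasDerivAt (fun s : ℝ => ∫ u in (0 : ℝ)..s, f (x + u • h)) (f x) 0 := by
      simpa using intervalIntegral.integral_hasDerivAt_right
        (hcont.intervalIntegrable 0 0)
        (hcont.stronglyMeasurableAtFilter _ _) hcont.continuousAt
    have hb : HasDerivAt (fun s : ℝ => ∫ u in (0 : ℝ)..s, f (x + u • h)) (f (x - h))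
        ((0 : ℝ) - 1) := by
      have := intervalIntegral.integral_hasDerivAt_right
        (hcont.intervalIntegrable 0 (0 - 1))
        (hcont.stronglyMeasurableAtFilter _ _) hcont.continuousAt
      simpa [sub_eq_add_neg] using this
    exact ha.sub (hb.comp_sub_const (0 : ℝ) 1)
  rw [heq] at h1
  exact h1.unique h2

theorem divergence_smul_const {d : ℕ} {g : Space d → ℝ} {x : Space d}
    (hg : DifferentiableAt ℝ g x) (h : Space d) :
    divergence (fun y => g y • h) x = fderiv ℝ g x h := by
  have hsum : h = ∑ k : Fin d, h k • EuclideanSpace.single k (1 : ℝ) := by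
    ext i
    simp [Pi.single_apply]
  conv_rhs => rw [hsum, map_sum]
  rw [divergence]
  refine Finset.sum_congr rfl fun k _ => ?_
  rw [(hg.hasFDerivAt.smul_const h).fderiv]
  simp [mul_comm]

theorem setIntegral_divergence_le {d : ℕ} {E U : Set (Space d)} {X : Space d → Space d} {c : ℝ}
    (hc : 0 < c) (hX : ContDiff ℝ 1 X) (hcs : HasCompactSupport X) (hU : tsupport X ⊆ U)
    (hle : ∀ x, ‖X x‖ ≤ c) :
    ENNReal.ofReal (∫ x in E, divergence X x) ≤ ENNReal.ofReal c * openVariation E U := by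
  have hts : tsupport (fun x => c⁻¹ • X x) ⊆ tsupport X :=
    closure_mono (Function.support_const_smul_subset c⁻¹ X)
  have ht : IsTestField U (fun x => c⁻¹ • X x) :=
    { contDiff := by fun_prop
      hasCompactSupport := hcs.smul_left (f := fun _ => c⁻¹)
      tsupport_subset := hts.trans hU
      norm_le_one := fun x => by
        rw [norm_smul, norm_inv, Real.norm_eq_abs, abs_of_pos hc, inv_mul_le_iff₀ hc, mul_one]
        exact hle x }
  have hdiv : ∀ x, divergence X x = c * divergence (fun x => c⁻¹ • X x) x := by
    intro x
    have hd : DifferentiableAt ℝ X x := hX.differentiable one_ne_zero x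
    simp only [divergence, Finset.mul_sum]
    refine Finset.sum_congr rfl fun k _ => ?_
    rw [fderiv_fun_const_smul hd]
    simp [hc.ne']
  simp_rw [hdiv]
  rw [integral_const_mul, ENNReal.ofReal_mul hc.le]
  gcongr
  exact le_iSup₂_of_le _ ht le_rfl

/-- The difference `f x - f (x - h)` is the divergence of `segmentAverage f h • h`, a field of norm
at most `‖h‖` whose support exceeds that of `f` by at most `‖h‖`. -/
theorem setIntegral_sub_translate_le {d : ℕ} {E U : Set (Space d)} {f : Space d → ℝ}
    (hf : ContDiff ℝ 1 f) {x₀ : Space d} {R : ℝ} (hs : tsupport f ⊆ closedBall x₀ R)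
    (hle : ∀ x, |f x| ≤ 1) {h : Space d} (hU : closedBall x₀ (R + ‖h‖) ⊆ U) :
    ENNReal.ofReal (∫ x in E, (f x - f (x - h))) ≤
      ENNReal.ofReal ‖h‖ * openVariation E U := by
  rcases eq_or_ne h 0 with rfl | hh
  · simp
  have hc : HasCompactSupport f :=
    (isCompact_closedBall x₀ R).of_isClosed_subset (isClosed_tsupport f) hs
  have hcd := contDiff_segmentAverage hf hc h
  have hts : tsupport (fun x => segmentAverage f h x • h) ⊆ closedBall x₀ (R + ‖h‖) :=
    (closure_mono (Function.support_smul_subset_left _ _)).trans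
      (tsupport_segmentAverage_subset hs h)
  have := setIntegral_divergence_le (E := E) (U := U) (X := fun x => segmentAverage f h x • h)
    (norm_pos_iff.2 hh)
    (hcd.smul contDiff_const)
    ((isCompact_closedBall _ _).of_isClosed_subset (isClosed_tsupport _) hts) (hts.trans hU)
    (fun x => by
      rw [norm_smul]
      exact mul_le_of_le_one_left (norm_nonneg _) (abs_segmentAverage_le hle h x))
  simpa only [divergence_smul_const (hcd.differentiable one_ne_zero _),
    fderiv_segmentAverage hf hc] using this

/-- The points whose membership in `E` changes under translation by `h`. -/
def shiftDiff {d : ℕ} (E : Set (Space d)) (h : Space d) : Set (Space d) :=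
  {x | ¬(x ∈ E ↔ x + h ∈ E)}

theorem measurableSet_shiftDiff {d : ℕ} {E : Set (Space d)} (hE : MeasurableSet E)
    (h : Space d) : MeasurableSet (shiftDiff E h) := by
  have h2 : MeasurableSet {x : Space d | x + h ∈ E} := (measurable_add_const h) hE
  exact (MeasurableSet.iff hE h2).compl

theorem setIntegral_sub_translate_eq {d : ℕ} {E : Set (Space d)} (hE : MeasurableSet E)
    {f : Space d → ℝ} (hf : Integrable f) (h : Space d) :
    ∫ x in E, (f x - f (x - h)) =
      ∫ x, (E.indicator (fun _ => (1 : ℝ)) x - E.indicator (fun _ => (1 : ℝ)) (x + h)) * f x := by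
  have hf' : Integrable (fun x => f (x - h)) := hf.comp_sub_right h
  have e1 : ∀ x, E.indicator (fun _ => (1 : ℝ)) x * f x = E.indicator f x := by
    intro x; by_cases hx : x ∈ E <;> simp [hx]
  have i2 : Integrable (fun x => E.indicator (fun _ => (1 : ℝ)) (x + h) * f x) := by
    have := ((hf'.indicator hE).comp_add_right h)
    refine this.congr (ae_of_all _ fun x => ?_)
    by_cases hx : x + h ∈ E <;> simp [hx]
  have i1 : Integrable (fun x => E.indicator (fun _ => (1 : ℝ)) x * f x) := by
    simp_rw [e1]; exact hf.indicator hE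
  rw [integral_sub hf.integrableOn hf'.integrableOn]
  simp_rw [sub_mul]
  rw [integral_sub i1 i2]
  simp_rw [e1]
  rw [integral_indicator hE]
  congr 1
  rw [← integral_indicator hE, ← integral_add_right_eq_self _ h]
  congr 1
  ext x
  by_cases hx : x + h ∈ E <;> simp [hx]

/-- Duality: pairing `1_E - 1_E(· + h)` with its own restriction `u` to the ball gives exactly the
measure sought. Since `u` is not smooth, it is mollified; this keeps the bound 1, enlarges the
support by at most `δ`, and passes to the limit by dominated convergence. -/
theorem volume_ball_inter_shiftDiff_le {d : ℕ} {E U : Set (Space d)} (hE : MeasurableSet E)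
    {x₀ h : Space d} {R δ : ℝ} (hδ : 0 < δ) (hU : closedBall x₀ (R + δ + ‖h‖) ⊆ U) :
    volume (ball x₀ R ∩ shiftDiff E h) ≤ ENNReal.ofReal ‖h‖ * openVariation E U := by
  set g : Space d → ℝ := fun x =>
    E.indicator (fun _ => (1 : ℝ)) x - E.indicator (fun _ => (1 : ℝ)) (x + h) with hg
  set u : Space d → ℝ := (ball x₀ R).indicator g with hu
  have hind : Measurable (E.indicator (fun _ => (1 : ℝ))) := measurable_const.indicator hE
  have hgm : Measurable g := hind.sub (hind.comp (measurable_add_const h))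
  have hum : Measurable u := hgm.indicator measurableSet_ball
  have hgle : ∀ x, |g x| ≤ 1 := by
    intro x
    by_cases h1 : x ∈ E <;> by_cases h2 : x + h ∈ E <;> simp [hg, h1, h2]
  have hule : ∀ x, |u x| ≤ 1 := by
    intro x
    by_cases h1 : x ∈ ball x₀ R
    · rw [hu, indicator_of_mem h1]; exact hgle x
    · rw [hu, indicator_of_notMem h1]; simp
  have hui : Integrable u := by
    rw [hu, integrable_indicator_iff measurableSet_ball]
    exact Measure.integrableOn_of_bounded measure_ball_lt_top.ne hgm.aestronglyMeasurable
      (M := 1) (ae_of_all _ hgle)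
  let φ : ℕ → ContDiffBump (0 : Space d) := fun n =>
    { rIn := δ / 2 / (n + 1)
      rOut := δ / (n + 1)
      rIn_pos := by positivity
      rIn_lt_rOut := by
        apply div_lt_div_of_pos_right _ (by positivity)
        linarith }
  have hφle : ∀ n, (φ n).rOut ≤ δ := fun n =>
    div_le_self hδ.le (by simp)
  have hφ0 : Tendsto (fun n => (φ n).rOut) atTop (𝓝 0) := by
    have := (tendsto_one_div_add_atTop_nhds_zero_nat (𝕜 := ℝ)).const_mul δ
    simpa [φ, div_eq_mul_inv] using this
  -- The bounded ratio of the radii is what Lebesgue differentiation needs for convergence almost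
  -- everywhere.
  have hφ2 : ∀ᶠ n in atTop, (φ n).rOut ≤ 2 * (φ n).rIn := by
    refine Eventually.of_forall fun n => le_of_eq ?_
    simp only [φ]
    ring
  let f : ℕ → Space d → ℝ := fun n => (φ n).normed volume ⋆[ContinuousLinearMap.lsmul ℝ ℝ] u
  have hlim : ∀ᵐ x, Tendsto (fun n => f n x) atTop (𝓝 (u x)) :=
    ContDiffBump.ae_convolution_tendsto_right_of_locallyIntegrable hφ0 hφ2 hui.locallyIntegrable
  have hfd : ∀ n, ContDiff ℝ 1 (f n) := fun n =>
    (φ n).hasCompactSupport_normed.contDiff_convolution_left _ (φ n).contDiff_normed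
      hui.locallyIntegrable
  have hfle : ∀ n x, |f n x| ≤ 1 := by
    intro n x
    have := dist_convolution_le (μ := volume) (f := (φ n).normed volume) (g := u) (x₀ := x)
      (R := (φ n).rOut) (ε := 1) (z₀ := 0) zero_le_one (φ n).support_normed_eq.subset
      (φ n).nonneg_normed (φ n).integral_normed hum.aestronglyMeasurable
      (fun y _ => by simpa using hule y)
    simpa using this
  have hsupp : ∀ n, tsupport (f n) ⊆ closedBall x₀ (R + δ) := by
    intro n
    refine closure_minimal ?_ isClosed_closedBall
    refine (support_convolution_subset _).trans ?_
    rw [(φ n).support_normed_eq]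
    rintro _ ⟨a, ha, b, hb, rfl⟩
    have hb' : b ∈ ball x₀ R := support_indicator_subset hb
    rw [mem_ball, dist_eq_norm] at ha hb'
    rw [mem_closedBall, dist_eq_norm]
    have h1 : ‖a + b - x₀‖ ≤ ‖a - 0‖ + ‖b - x₀‖ := by
      refine le_trans (le_of_eq ?_) (norm_add_le _ _)
      congr 1; abel
    linarith [hφle n]
  have hfi : ∀ n, Integrable (f n) := fun n =>
    (hfd n).continuous.integrable_of_hasCompactSupport
      ((isCompact_closedBall x₀ (R + δ)).of_isClosed_subset (isClosed_tsupport _) (hsupp n))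
  have hle : ∀ n, ENNReal.ofReal (∫ x, g x * f n x) ≤ ENNReal.ofReal ‖h‖ * openVariation E U := by
    intro n
    rw [← setIntegral_sub_translate_eq hE (hfi n) h]
    exact setIntegral_sub_translate_le (hfd n) (hsupp n) (hfle n) hU
  have hconv : Tendsto (fun n => ∫ x, g x * f n x) atTop (𝓝 (∫ x, g x * u x)) := by
    refine tendsto_integral_of_dominated_convergence
      ((closedBall x₀ (R + δ)).indicator fun _ => (1 : ℝ)) ?_ ?_ ?_ ?_
    · exact fun n => (hgm.aestronglyMeasurable).mul (hfd n).continuous.aestronglyMeasurable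
    · exact (integrable_indicator_iff measurableSet_closedBall).2
        (integrableOn_const measure_closedBall_lt_top.ne)
    · refine fun n => ae_of_all _ fun x => ?_
      by_cases hx : x ∈ closedBall x₀ (R + δ)
      · rw [indicator_of_mem hx, norm_mul]
        exact mul_le_one₀ (hgle x) (norm_nonneg _) (hfle n x)
      · rw [image_eq_zero_of_notMem_tsupport (fun h' => hx (hsupp n h'))]
        simp [hx]
    · filter_upwards [hlim] with x hx using hx.const_mul _
  have hval : ∫ x, g x * u x = volume.real (ball x₀ R ∩ shiftDiff E h) := by
    rw [← integral_indicator_one (measurableSet_ball.inter (measurableSet_shiftDiff hE h))]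
    congr 1
    ext x
    by_cases h0 : x ∈ ball x₀ R
    · have h0' := h0
      rw [mem_ball] at h0'
      by_cases h1 : x ∈ E <;> by_cases h2 : x + h ∈ E <;>
        simp [hg, hu, h1, h2, h0', shiftDiff, indicator]
    · have h0' := h0
      rw [mem_ball] at h0'
      simp [hu, h0', indicator]
  have hfin : volume (ball x₀ R ∩ shiftDiff E h) ≠ ∞ :=
    ((measure_mono inter_subset_left).trans_lt measure_ball_lt_top).ne
  have := le_of_tendsto' (ENNReal.tendsto_ofReal hconv) hle
  rwa [hval, ofReal_measureReal hfin] at this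

theorem volume_shiftDiff_le {d : ℕ} {E : Set (Space d)} (hE : MeasurableSet E) (h : Space d) :
    volume (shiftDiff E h) ≤ ENNReal.ofReal ‖h‖ * openVariation E univ := by
  have hmono : Monotone fun n : ℕ => ball (0 : Space d) n ∩ shiftDiff E h := fun a b hab =>
    inter_subset_inter_left _ (ball_subset_ball (by exact_mod_cast hab))
  have hU : ⋃ n : ℕ, ball (0 : Space d) n ∩ shiftDiff E h = shiftDiff E h := by
    rw [← iUnion_inter, iUnion_ball_nat, univ_inter]
  rw [← hU, hmono.measure_iUnion]
  exact iSup_le fun n => volume_ball_inter_shiftDiff_le hE one_pos (subset_univ _)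

theorem volume_ball_quarter_inter_shiftDiff_le {d : ℕ} {E : Set (Space d)}
    (hE : MeasurableSet E) (x₀ : Space d) {h : Space d} (hh : ‖h‖ ≤ 1 / 4) :
    volume (ball x₀ (1 / 4) ∩ shiftDiff E h) ≤
      ENNReal.ofReal ‖h‖ * openVariation E (ball x₀ 1) :=
  -- The ball radius, the mollification radius and the shift add up to at most 3/4, inside the unit
  -- ball where the perimeter is controlled.
  volume_ball_inter_shiftDiff_le hE (δ := 1 / 4) (by norm_num)
    (closedBall_subset_ball (by linarith))

/-! ### Separation of points from their neighbourhoods -/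

/-- The measure of the points of the ball of radius `r` around `x` which `G` separates
from `x`. -/
noncomputable def separation {d : ℕ} (G : Set (Space d)) (r : ℝ) (x : Space d) : ℝ≥0∞ :=
  volume ({h | x ∈ shiftDiff G h} ∩ ball (0 : Space d) r)

theorem measurableSet_prod_shiftDiff {d : ℕ} {G : Set (Space d)} (hG : MeasurableSet G) :
    MeasurableSet {p : Space d × Space d | p.1 ∈ shiftDiff G p.2} := by
  have h1 : MeasurableSet {p : Space d × Space d | p.1 ∈ G} := measurable_fst hG
  have h2 : MeasurableSet {p : Space d × Space d | p.1 + p.2 ∈ G} :=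
    (measurable_fst.add measurable_snd) hG
  exact (MeasurableSet.iff h1 h2).compl

theorem measurable_separation {d : ℕ} {G : Set (Space d)} (hG : MeasurableSet G) (r : ℝ) :
    Measurable (separation G r) :=
  measurable_measure_prodMk_left ((measurableSet_prod_shiftDiff hG).inter
    (measurable_snd measurableSet_ball))

theorem measurable_volume_inter_ball {d : ℕ} {G : Set (Space d)} (hG : MeasurableSet G) (r : ℝ) :
    Measurable fun x => volume (G ∩ ball x r) := by
  have h2 : MeasurableSet {p : Space d × Space d | dist p.2 p.1 < r} :=
    measurableSet_lt (measurable_snd.dist measurable_fst) measurable_const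
  exact measurable_measure_prodMk_left ((measurable_snd hG).inter h2)

theorem separation_of_mem {d : ℕ} {G : Set (Space d)} (r : ℝ) {x : Space d} (hx : x ∈ G) :
    separation G r x = volume (ball x r \ G) := by
  rw [separation, ← measure_preimage_add volume x (ball x r \ G)]
  congr 1
  ext h
  simp [shiftDiff, hx, and_comm]

theorem separation_of_notMem {d : ℕ} {G : Set (Space d)} (r : ℝ) {x : Space d} (hx : x ∉ G) :
    separation G r x = volume (G ∩ ball x r) := by
  rw [separation, ← measure_preimage_add volume x (G ∩ ball x r)]
  congr 1
  ext h
  simp [shiftDiff, hx]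

/-- Tonelli: integrating first in `x` for fixed `h` turns the left side into an average of the shift
differences. -/
theorem lintegral_separation_le {d : ℕ} {G K : Set (Space d)} (hG : MeasurableSet G)
    {r : ℝ} {c : ℝ≥0∞} (hc : ∀ h ∈ ball (0 : Space d) r, volume (K ∩ shiftDiff G h) ≤ c) :
    ∫⁻ x in K, separation G r x ≤ c * volume (ball (0 : Space d) r) := by
  have hS := measurableSet_prod_shiftDiff hG
  have h1 := Measure.prod_apply (μ := volume.restrict K)
    (ν := volume.restrict (ball (0 : Space d) r)) hS
  have h2 := Measure.prod_apply_symm (μ := volume.restrict K)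
    (ν := volume.restrict (ball (0 : Space d) r)) hS
  have h3 : ∫⁻ x in K, separation G r x = ∫⁻ x in K,
      volume.restrict (ball (0 : Space d) r)
        (Prod.mk x ⁻¹' {p : Space d × Space d | p.1 ∈ shiftDiff G p.2}) := by
    refine lintegral_congr fun x => ?_
    rw [Measure.restrict_apply (measurable_prodMk_left hS)]
    rfl
  rw [h3, ← h1, h2, ← setLIntegral_const]
  refine setLIntegral_mono measurable_const fun h hh => ?_
  rw [Measure.restrict_apply (measurable_prodMk_right hS), inter_comm]
  exact hc h hh

/-- A part of a set of small perimeter around which the set has density at most `1 / 2`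
is small. -/
theorem volume_le_of_density_le_half {d : ℕ} {G S : Set (Space d)} (hG : MeasurableSet G)
    (hSG : S ⊆ G) {r : ℝ} (hr : 0 < r) {c : ℝ≥0∞}
    (hc : ∀ h ∈ ball (0 : Space d) r, volume (shiftDiff G h) ≤ c)
    (hd : ∀ x ∈ S, 2 * volume (G ∩ ball x r) ≤ volume (ball (0 : Space d) r)) :
    volume S ≤ 2 * c := by
  set v := volume (ball (0 : Space d) r) with hv
  have hv0 : v ≠ 0 := (measure_ball_pos _ _ hr).ne'
  have hvt : v ≠ ∞ := measure_ball_lt_top.ne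
  -- At a point of low density at least half of the ball lies outside `G`, hence is separated from
  -- `x`; integrating over `S` compares `S` with the shift differences.
  have key : ∀ x ∈ S, v ≤ 2 * separation G r x := by
    intro x hx
    have h1 : volume (G ∩ ball x r) + separation G r x = v := by
      rw [separation_of_mem r (hSG hx), inter_comm, measure_inter_add_sdiff _ hG, hv,
        Measure.addHaar_ball_center]
    have h2 : v + v ≤ v + 2 * separation G r x := by
      calc v + v = 2 * volume (G ∩ ball x r) + 2 * separation G r x := by
            rw [← mul_add, h1, two_mul]
        _ ≤ _ := by gcongr; exact hd x hx
    exact (ENNReal.add_le_add_iff_left hvt).1 h2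
  have h3 : v * volume S ≤ v * (2 * c) := by
    calc v * volume S = ∫⁻ _ in S, v := (setLIntegral_const _ _).symm
      _ ≤ ∫⁻ x in S, 2 * separation G r x :=
        setLIntegral_mono ((measurable_separation hG r).const_mul 2) key
      _ = 2 * ∫⁻ x in S, separation G r x := lintegral_const_mul _ (measurable_separation hG r)
      _ ≤ 2 * (c * v) := by
        gcongr
        exact lintegral_separation_le hG fun h hh =>
          (measure_mono inter_subset_right).trans (hc h hh)
      _ = v * (2 * c) := by ring
  exact (ENNReal.mul_le_mul_iff_right hv0 hvt).1 h3

/-! ### Local compactness in measure -/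

/-- Uniform local Lipschitz bound for the translations of a set. -/
def HasShiftBound {d : ℕ} (C : ℝ≥0∞) (G : Set (Space d)) : Prop :=
  ∀ x₀ h : Space d, ‖h‖ ≤ 1 / 4 →
    volume (ball x₀ (1 / 4) ∩ shiftDiff G h) ≤ ENNReal.ofReal ‖h‖ * C

/-- If `x ∈ G \ H`, the part of the ball outside `G` and the part inside `H` are both separations,
and what is missing to fill the ball is the excess of the volume of `G` over that of `H`. The two
truncated differences together form an absolute difference, so apart from an `O(r)` error only
averages at scale `r` matter. -/
theorem volume_symmDiff_inter_ball_le {d : ℕ} {G H : Set (Space d)} (hG : MeasurableSet G)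
    (hH : MeasurableSet H) {C : ℝ≥0∞} (hGC : HasShiftBound C G) (hHC : HasShiftBound C H)
    {r : ℝ} (hr : r ≤ 1 / 4) (x₀ : Space d) :
    volume (ball (0 : Space d) r) * volume (symmDiff G H ∩ ball x₀ (1 / 4)) ≤
      2 * (ENNReal.ofReal r * C * volume (ball (0 : Space d) r)) +
      ∫⁻ x in ball x₀ (1 / 4), ((volume (G ∩ ball x r) - volume (H ∩ ball x r)) +
        (volume (H ∩ ball x r) - volume (G ∩ ball x r))) := by
  set v := volume (ball (0 : Space d) r) with hv
  have key : ∀ (G H : Set (Space d)), MeasurableSet G → ∀ x, x ∈ G → x ∉ H →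
      v ≤ separation G r x + separation H r x +
        (volume (G ∩ ball x r) - volume (H ∩ ball x r)) := by
    intro G H hG x hxG hxH
    have h1 : volume (G ∩ ball x r) + separation G r x = v := by
      rw [separation_of_mem r hxG, inter_comm, measure_inter_add_sdiff _ hG, hv,
        Measure.addHaar_ball_center]
    rw [← h1, separation_of_notMem r hxH, add_comm, add_assoc]
    gcongr
    exact le_add_tsub
  have key' : ∀ x ∈ symmDiff G H, v ≤ separation G r x + separation H r x +
      ((volume (G ∩ ball x r) - volume (H ∩ ball x r)) +
        (volume (H ∩ ball x r) - volume (G ∩ ball x r))) := by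
    rintro x (⟨h1, h2⟩ | ⟨h1, h2⟩)
    · exact (key G H hG x h1 h2).trans (by gcongr; exact le_self_add)
    · refine (key H G hH x h1 h2).trans ?_
      rw [add_comm (separation H r x)]
      gcongr
      exact le_add_self
  have mG := measurable_separation hG r
  have mH := measurable_separation hH r
  have aG := measurable_volume_inter_ball hG r
  have aH := measurable_volume_inter_ball hH r
  have hs : ∀ G, MeasurableSet G → HasShiftBound C G →
      ∫⁻ x in ball x₀ (1 / 4), separation G r x ≤ ENNReal.ofReal r * C * v := by
    intro G hG hGC
    refine lintegral_separation_le hG fun h hh => ?_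
    rw [mem_ball_zero_iff] at hh
    refine (hGC x₀ h (hh.le.trans hr)).trans ?_
    gcongr
  calc v * volume (symmDiff G H ∩ ball x₀ (1 / 4))
      = ∫⁻ _ in symmDiff G H ∩ ball x₀ (1 / 4), v := (setLIntegral_const _ _).symm
    _ ≤ ∫⁻ x in symmDiff G H ∩ ball x₀ (1 / 4), (separation G r x + separation H r x +
        ((volume (G ∩ ball x r) - volume (H ∩ ball x r)) +
          (volume (H ∩ ball x r) - volume (G ∩ ball x r)))) :=
      setLIntegral_mono (by fun_prop) fun x hx => key' x hx.1
    _ ≤ ∫⁻ x in ball x₀ (1 / 4), (separation G r x + separation H r x +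
        ((volume (G ∩ ball x r) - volume (H ∩ ball x r)) +
          (volume (H ∩ ball x r) - volume (G ∩ ball x r)))) :=
      lintegral_mono_set inter_subset_right
    _ = (∫⁻ x in ball x₀ (1 / 4), separation G r x) + (∫⁻ x in ball x₀ (1 / 4), separation H r x) +
        ∫⁻ x in ball x₀ (1 / 4), ((volume (G ∩ ball x r) - volume (H ∩ ball x r)) +
          (volume (H ∩ ball x r) - volume (G ∩ ball x r))) := by
      rw [← lintegral_add_left mG]
      exact lintegral_add_left (mG.add mH) _
    _ ≤ _ := by
      rw [two_mul]
      gcongr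
      · exact hs G hG hGC
      · exact hs H hH hHC

theorem tendsto_volume_ball_add_sub {d : ℕ} {r : ℝ} (hr : 0 < r) :
    Tendsto (fun δ : ℝ => volume (ball (0 : Space d) (r + δ)) - volume (ball (0 : Space d) r))
      (𝓝[>] 0) (𝓝 0) := by
  have h1 : Tendsto (fun δ : ℝ => volume (ball (0 : Space d) (r + δ))) (𝓝[>] 0)
      (𝓝 (volume (ball (0 : Space d) r))) := by
    have hf : ∀ s : ℝ, 0 < s → volume (ball (0 : Space d) s) =
        ENNReal.ofReal (s ^ Module.finrank ℝ (Space d)) * volume (ball (0 : Space d) 1) :=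
      fun s hs => Measure.addHaar_ball_of_pos _ _ hs
    rw [hf r hr]
    have h2 : Tendsto (fun δ : ℝ => ENNReal.ofReal ((r + δ) ^ Module.finrank ℝ (Space d)) *
        volume (ball (0 : Space d) 1)) (𝓝[>] 0)
        (𝓝 (ENNReal.ofReal (r ^ Module.finrank ℝ (Space d)) * volume (ball (0 : Space d) 1))) := by
      refine ENNReal.Tendsto.mul_const ?_ (Or.inr measure_ball_lt_top.ne)
      refine ENNReal.tendsto_ofReal ?_
      have : Continuous fun δ : ℝ => (r + δ) ^ Module.finrank ℝ (Space d) := by fun_prop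
      simpa using (this.tendsto 0).mono_left nhdsWithin_le_nhds
    refine h2.congr' ?_
    filter_upwards [self_mem_nhdsWithin] with δ hδ
    exact (hf _ (add_pos hr hδ)).symm
  have := ENNReal.Tendsto.sub h1 (tendsto_const_nhds (x := volume (ball (0 : Space d) r)))
    (Or.inl measure_ball_lt_top.ne)
  simpa using this

theorem volume_inter_ball_le_add {d : ℕ} (G : Set (Space d)) {r δ : ℝ}
    {x y : Space d} (hxy : dist x y ≤ δ) : volume (G ∩ ball x r) ≤ volume (G ∩ ball y r) +
      (volume (ball (0 : Space d) (r + δ)) - volume (ball (0 : Space d) r)) := by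
  have hδ : 0 ≤ δ := dist_nonneg.trans hxy
  have h1 : G ∩ ball x r ⊆ (G ∩ ball y r) ∪ (ball y (r + δ) \ ball y r) := by
    rintro z ⟨hz, hzx⟩
    by_cases h : z ∈ ball y r
    · exact Or.inl ⟨hz, h⟩
    · refine Or.inr ⟨?_, h⟩
      rw [mem_ball] at hzx ⊢
      linarith [dist_triangle z x y]
  refine (measure_mono h1).trans ((measure_union_le _ _).trans ?_)
  gcongr
  rw [measure_sdiff (ball_subset_ball (by linarith)) measurableSet_ball.nullMeasurableSet
    measure_ball_lt_top.ne, Measure.addHaar_ball_center, Measure.addHaar_ball_center _ y]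

theorem exists_tendsto_volume_inter_ball {d : ℕ} {G : ℕ → Set (Space d)} {D : Set (Space d)}
    (hD : Dense D) {r : ℝ} (hr : 0 < r)
    (h : ∀ q ∈ D, ∃ l, Tendsto (fun n => volume (G n ∩ ball q r)) atTop (𝓝 l)) (x : Space d) :
    ∃ l, Tendsto (fun n => volume (G n ∩ ball x r)) atTop (𝓝 l) := by
  -- The limit is taken to be the liminf. Averages vary with the centre at a rate independent of the
  -- set, so a nearby `q ∈ D` shows that the limsup exceeds it by at most `ε`.
  refine ⟨_, tendsto_of_le_liminf_of_limsup_le le_rfl ?_⟩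
  refine ENNReal.le_of_forall_pos_le_add fun ε hε _ => ?_
  have hε' : (0 : ℝ≥0∞) < ε / 2 := by simpa using hε.ne'
  obtain ⟨δ, hη, hδ⟩ := (((tendsto_volume_ball_add_sub (d := d) hr).eventually
    (ge_mem_nhds hε')).and self_mem_nhdsWithin).exists
  obtain ⟨q, hq, hqx⟩ := hD.exists_dist_lt x hδ
  obtain ⟨l, hl⟩ := h q hq
  have h1 : limsup (fun n => volume (G n ∩ ball x r)) atTop ≤ l + ε / 2 := by
    rw [← (hl.add_const (ε / 2 : ℝ≥0∞)).limsup_eq]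
    exact limsup_le_limsup (Eventually.of_forall fun n =>
      (volume_inter_ball_le_add _ hqx.le).trans (add_le_add le_rfl hη))
  have h2 : l - ε / 2 ≤ liminf (fun n => volume (G n ∩ ball x r)) atTop := by
    rw [← (ENNReal.Tendsto.sub hl tendsto_const_nhds
      (Or.inr (ENNReal.div_ne_top ENNReal.coe_ne_top two_ne_zero))).liminf_eq]
    refine liminf_le_liminf (Eventually.of_forall fun n => ?_)
    rw [tsub_le_iff_right]
    exact (volume_inter_ball_le_add _ ((dist_comm q x).trans_le hqx.le)).trans
      (add_le_add le_rfl hη)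
  calc _ ≤ l + ε / 2 := h1
    _ ≤ liminf (fun n => volume (G n ∩ ball x r)) atTop + ε / 2 + ε / 2 := by
      gcongr; exact tsub_le_iff_right.1 h2
    _ = _ := by rw [add_assoc, ENNReal.add_halves]

theorem tendsto_two_mul_ofReal_mul {C : ℝ≥0∞} (hC : C ≠ ∞) :
    Tendsto (fun k : ℕ => 2 * (ENNReal.ofReal (1 / (k + 4 : ℝ)) * C)) atTop (𝓝 0) := by
  have h1 : Tendsto (fun k : ℕ => 1 / (k + 4 : ℝ)) atTop (𝓝 0) :=
    tendsto_const_nhds.div_atTop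
      (tendsto_atTop_add_const_right atTop (4 : ℝ) (tendsto_natCast_atTop_atTop (R := ℝ)))
  have h2 := ENNReal.Tendsto.const_mul (a := 2) (ENNReal.Tendsto.mul_const
    (ENNReal.tendsto_ofReal h1) (Or.inr hC)) (Or.inr ENNReal.ofNat_ne_top)
  simpa using h2

/-- The scale is fixed first, so that the separation error is below `ε / 2` for all indices; at that
scale the averages are Cauchy and bounded, and dominated convergence finishes. The radii `1 / (k +
4)` are countably many, tend to 0 and never exceed the 1/4 allowed in `HasShiftBound`. -/
theorem tendsto_volume_symmDiff_inter_ball {d : ℕ} {G : ℕ → Set (Space d)}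
    (hG : ∀ n, MeasurableSet (G n)) {C : ℝ≥0∞} (hC : C ≠ ∞) (hGC : ∀ n, HasShiftBound C (G n))
    (hlim : ∀ k : ℕ, ∀ x, ∃ l,
      Tendsto (fun n => volume (G n ∩ ball x (1 / (k + 4 : ℝ)))) atTop (𝓝 l)) (x₀ : Space d) :
    Tendsto (fun p : ℕ × ℕ => volume (symmDiff (G p.1) (G p.2) ∩ ball x₀ (1 / 4)))
      (atTop ×ˢ atTop) (𝓝 0) := by
  rw [ENNReal.tendsto_nhds_zero]
  intro ε hε
  have hε2 : (0 : ℝ≥0∞) < ε / 2 := ENNReal.half_pos hε.ne'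
  obtain ⟨k, hk⟩ := ((tendsto_two_mul_ofReal_mul hC).eventually (ge_mem_nhds hε2)).exists
  set r : ℝ := 1 / (k + 4 : ℝ) with hr
  have hrpos : 0 < r := by positivity
  have hr4 : r ≤ 1 / 4 := by
    rw [hr]; gcongr; simp
  set v := volume (ball (0 : Space d) r) with hv
  have hv0 : v ≠ 0 := (measure_ball_pos _ _ hrpos).ne'
  have hvt : v ≠ ∞ := measure_ball_lt_top.ne
  have hle : ∀ (A : Set (Space d)) x, volume (A ∩ ball x r) ≤ v := fun A x =>
    (measure_mono inter_subset_right).trans_eq (Measure.addHaar_ball_center _ _ _)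
  have hint : Tendsto (fun p : ℕ × ℕ => ∫⁻ x in ball x₀ (1 / 4),
      ((volume (G p.1 ∩ ball x r) - volume (G p.2 ∩ ball x r)) +
        (volume (G p.2 ∩ ball x r) - volume (G p.1 ∩ ball x r)))) (atTop ×ˢ atTop) (𝓝 0) := by
    rw [← lintegral_zero (μ := volume.restrict (ball x₀ (1 / 4)))]
    refine tendsto_lintegral_filter_of_dominated_convergence (fun _ => v + v) ?_ ?_ ?_ ?_
    · refine Eventually.of_forall fun p => ?_
      have h1 := measurable_volume_inter_ball (hG p.1) r
      have h2 := measurable_volume_inter_ball (hG p.2) r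
      fun_prop
    · exact Eventually.of_forall fun p => ae_of_all _ fun x =>
        add_le_add (tsub_le_self.trans (hle _ _)) (tsub_le_self.trans (hle _ _))
    · rw [setLIntegral_const]
      exact ENNReal.mul_ne_top (ENNReal.add_ne_top.2 ⟨hvt, hvt⟩) measure_ball_lt_top.ne
    · refine ae_of_all _ fun x => ?_
      obtain ⟨l, hl⟩ := hlim k x
      have hlt : l ≠ ∞ := ((le_of_tendsto' hl fun n => hle _ x).trans_lt hvt.lt_top).ne
      have h1 := hl.comp (tendsto_fst (f := (atTop : Filter ℕ)) (g := (atTop : Filter ℕ)))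
      have h2 := hl.comp (tendsto_snd (f := (atTop : Filter ℕ)) (g := (atTop : Filter ℕ)))
      have := (ENNReal.Tendsto.sub h1 h2 (Or.inl hlt)).add
        (ENNReal.Tendsto.sub h2 h1 (Or.inl hlt))
      rw [tsub_self, add_zero] at this
      exact this
  have hvε : (0 : ℝ≥0∞) < v * (ε / 2) := ENNReal.mul_pos hv0 hε2.ne'
  filter_upwards [hint.eventually (ge_mem_nhds hvε)] with p hp
  refine (ENNReal.mul_le_mul_iff_right hv0 hvt).1 ?_
  calc v * volume (symmDiff (G p.1) (G p.2) ∩ ball x₀ (1 / 4))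
      ≤ 2 * (ENNReal.ofReal r * C * v) + v * (ε / 2) :=
        (volume_symmDiff_inter_ball_le (hG _) (hG _) (hGC _) (hGC _) hr4 x₀).trans
          (add_le_add le_rfl hp)
    _ = v * (2 * (ENNReal.ofReal r * C)) + v * (ε / 2) := by ring
    _ ≤ v * (ε / 2) + v * (ε / 2) := by gcongr
    _ = v * ε := by rw [← mul_add, ENNReal.add_halves]

theorem tendsto_volume_inter_ball_of_small {d : ℕ} {ι : Type*} {l : Filter ι}
    {A : ι → Set (Space d)} {r : ℝ} (hr : 0 < r)
    (h : ∀ x₀, Tendsto (fun i => volume (A i ∩ ball x₀ r)) l (𝓝 0)) (R : ℝ) :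
    Tendsto (fun i => volume (A i ∩ ball 0 R)) l (𝓝 0) := by
  obtain ⟨t, ht⟩ := (isCompact_closedBall (0 : Space d) R).elim_finite_subcover
    (fun x : Space d => ball x r) (fun _ => isOpen_ball)
    (fun x _ => mem_iUnion.2 ⟨x, mem_ball_self hr⟩)
  have hsum : Tendsto (fun i => ∑ x ∈ t, volume (A i ∩ ball x r)) l (𝓝 0) := by
    simpa using tendsto_finsetSum t fun x _ => h x
  refine tendsto_of_tendsto_of_tendsto_of_le_of_le tendsto_const_nhds hsum
    (fun _ => zero_le) fun i => ?_
  refine (measure_mono ?_).trans (measure_biUnion_finset_le t _)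
  rintro x ⟨hx, hxR⟩
  obtain ⟨y, hy, hxy⟩ := mem_iUnion₂.1 (ht (ball_subset_closedBall hxR))
  exact mem_iUnion₂.2 ⟨y, hy, hx, hxy⟩

/-- Completeness of the space of measurable sets for local convergence in measure. -/
theorem exists_limit_of_tendsto_symmDiff {d : ℕ} {G : ℕ → Set (Space d)}
    (hG : ∀ n, MeasurableSet (G n))
    (h : ∀ R : ℝ, Tendsto (fun p : ℕ × ℕ => volume (symmDiff (G p.1) (G p.2) ∩ ball 0 R))
      (atTop ×ˢ atTop) (𝓝 0)) :
    ∃ F : Set (Space d), MeasurableSet F ∧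
      ∀ R : ℝ, Tendsto (fun n => volume (symmDiff (G n) F ∩ ball 0 R)) atTop (𝓝 0) := by
  have hex : ∀ k : ℕ, ∀ᶠ n in atTop, ∀ m ≥ n,
      volume (symmDiff (G n) (G m) ∩ ball 0 k) ≤ (2⁻¹ : ℝ≥0∞) ^ k := by
    intro k
    have hpos : (0 : ℝ≥0∞) < 2⁻¹ ^ k := ENNReal.pow_pos (by simp) k
    have := (h k).eventually (ge_mem_nhds hpos)
    rw [prod_atTop_atTop_eq, eventually_atTop] at this
    obtain ⟨⟨a, b⟩, hab⟩ := this
    filter_upwards [eventually_ge_atTop (max a b)] with n hn m hm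
    exact hab (n, m) ⟨(le_max_left _ _).trans hn, (le_max_right _ _).trans (hn.trans hm)⟩
  obtain ⟨φ, hφ, hφG⟩ := extraction_forall_of_eventually hex
  let F : Set (Space d) := {x | ∀ᶠ k in atTop, x ∈ G (φ k)}
  have hF : MeasurableSet F := by
    have : F = liminf (fun k => G (φ k)) atTop := by
      ext x
      simp [F, mem_liminf_iff_eventually_mem]
    rw [this]
    exact MeasurableSet.measurableSet_liminf fun k => hG _
  refine ⟨F, hF, fun R => ?_⟩
  have hmain : ∀ k : ℕ, R ≤ k → ∀ n ≥ φ k,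
      volume (symmDiff (G n) F ∩ ball 0 R) ≤ 3 * (2⁻¹ : ℝ≥0∞) ^ k := by
    intro k hk n hn
    -- A point outside all consecutive differences from `k` on has constant membership along the
    -- subsequence, hence the same membership in `F`. The measures of these differences sum to `2 *
    -- 2⁻¹ ^ k`, and comparing `G n` with `G (φ k)` costs one more `2⁻¹ ^ k`.
    have hsub : symmDiff (G n) F ∩ ball 0 R ⊆ (symmDiff (G (φ k)) (G n) ∩ ball 0 k) ∪
        ⋃ l : ℕ, symmDiff (G (φ (k + l))) (G (φ (k + l + 1))) ∩ ball 0 ((k + l : ℕ) : ℝ) := by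
      rintro x ⟨hx, hxR⟩
      have hxk : ∀ l : ℕ, x ∈ ball (0 : Space d) ((k + l : ℕ) : ℝ) := fun l =>
        ball_subset_ball (hk.trans (by exact_mod_cast Nat.le_add_right k l)) hxR
      by_contra hcon
      rw [mem_union, not_or, mem_iUnion, not_exists] at hcon
      have h1 : x ∈ G (φ k) ↔ x ∈ G n := by
        by_contra hne
        refine hcon.1 ⟨?_, hxk 0⟩
        rw [mem_symmDiff]; tauto
      have h2 : ∀ l : ℕ, x ∈ G (φ (k + l)) ↔ x ∈ G (φ k) := by
        intro l
        induction l with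
        | zero => rfl
        | succ l ih =>
          rw [← ih]
          by_contra hne
          refine hcon.2 l ⟨?_, hxk l⟩
          rw [mem_symmDiff]
          rw [← add_assoc] at hne
          tauto
      have h3 : x ∈ F ↔ x ∈ G (φ k) := by
        constructor
        · intro hxF
          obtain ⟨m, hm, hkm⟩ := (hxF.and (eventually_ge_atTop k)).exists
          obtain ⟨l, rfl⟩ := Nat.exists_eq_add_of_le hkm
          exact (h2 l).1 hm
        · intro hxG
          refine eventually_atTop.2 ⟨k, fun m hkm => ?_⟩
          obtain ⟨l, rfl⟩ := Nat.exists_eq_add_of_le hkm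
          exact (h2 l).2 hxG
      rw [mem_symmDiff] at hx
      tauto
    calc volume (symmDiff (G n) F ∩ ball 0 R)
        ≤ volume (symmDiff (G (φ k)) (G n) ∩ ball 0 k) + ∑' l : ℕ,
          volume (symmDiff (G (φ (k + l))) (G (φ (k + l + 1))) ∩ ball 0 ((k + l : ℕ) : ℝ)) :=
          (measure_mono hsub).trans ((measure_union_le _ _).trans
            (add_le_add le_rfl (measure_iUnion_le _)))
      _ ≤ 2⁻¹ ^ k + ∑' l : ℕ, (2⁻¹ : ℝ≥0∞) ^ k * 2⁻¹ ^ l := by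
          refine add_le_add (hφG k n hn) (ENNReal.tsum_le_tsum fun l => ?_)
          rw [← pow_add]
          exact hφG (k + l) _ (hφ.monotone (Nat.le_succ _))
      _ = 3 * 2⁻¹ ^ k := by
          rw [ENNReal.tsum_mul_left, ENNReal.tsum_geometric, ENNReal.one_sub_inv_two, inv_inv]
          ring
  rw [ENNReal.tendsto_nhds_zero]
  intro ε hε
  have hgeo : Tendsto (fun k : ℕ => 3 * (2⁻¹ : ℝ≥0∞) ^ k) atTop (𝓝 0) := by
    have := ENNReal.Tendsto.const_mul (a := 3)
      (ENNReal.tendsto_pow_atTop_nhds_zero_of_lt_one ENNReal.one_half_lt_one)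
      (Or.inr ENNReal.ofNat_ne_top)
    simpa using this
  obtain ⟨k, hkε, hkR⟩ := ((hgeo.eventually (ge_mem_nhds hε)).and
    (tendsto_natCast_atTop_atTop.eventually_ge_atTop R)).exists
  filter_upwards [eventually_ge_atTop (φ k)] with n hn
  exact (hmain k hkR n hn).trans hkε

theorem exists_limit_of_hasShiftBound {d : ℕ} {G : ℕ → Set (Space d)}
    (hG : ∀ n, MeasurableSet (G n)) {C : ℝ≥0∞} (hC : C ≠ ∞) (hGC : ∀ n, HasShiftBound C (G n))
    (hlim : ∀ k i : ℕ, ∃ l, Tendsto (fun n =>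
      volume (G n ∩ ball (TopologicalSpace.denseSeq (Space d) i) (1 / (k + 4 : ℝ)))) atTop (𝓝 l)) :
    ∃ F : Set (Space d), MeasurableSet F ∧
      ∀ R : ℝ, Tendsto (fun n => volume (symmDiff (G n) F ∩ ball 0 R)) atTop (𝓝 0) := by
  refine exists_limit_of_tendsto_symmDiff hG
    (tendsto_volume_inter_ball_of_small (r := 1 / 4) (by norm_num) ?_)
  refine tendsto_volume_symmDiff_inter_ball hG hC hGC fun k => ?_
  refine exists_tendsto_volume_inter_ball (TopologicalSpace.denseRange_denseSeq (Space d))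
    (by positivity) ?_
  rintro _ ⟨i, rfl⟩
  exact hlim k i

/-! ### Greedy exhaustion of concentrated mass -/

/-- Unit balls chosen successively so as to capture at least half of the largest available
remaining mass of `A` exhaust the concentrations of mass of `A`. -/
theorem exists_greedy_centers {d : ℕ} (A : Set (Space d)) :
    ∃ x : ℕ → Space d, ∀ (i : ℕ) (y : Space d),
      (i : ℝ≥0∞) * volume ((A ∩ ball y 1) \ ⋃ l < i, ball (x l) 1) ≤ 2 * volume A := by
  -- The supremum over centres need not be attained; half of it is, which is the origin of the
  -- factor 2.
  have hnext : ∀ U : Set (Space d), ∃ z : Space d, ∀ y,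
      volume ((A ∩ ball y 1) \ U) ≤ 2 * volume ((A ∩ ball z 1) \ U) := by
    intro U
    set s := ⨆ y : Space d, volume ((A ∩ ball y 1) \ U) with hs
    have hle : ∀ y, volume ((A ∩ ball y 1) \ U) ≤ s := fun y =>
      le_iSup (fun y : Space d => volume ((A ∩ ball y 1) \ U)) y
    rcases eq_or_ne s 0 with h0 | h0
    · exact ⟨0, fun y => (hle y).trans (by rw [h0]; exact zero_le)⟩
    · have hst : s ≠ ∞ := by
        refine ne_top_of_le_ne_top (measure_ball_lt_top (μ := volume) (x := (0 : Space d))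
          (r := 1)).ne (iSup_le fun y => ?_)
        exact (measure_mono (sdiff_subset.trans inter_subset_right)).trans_eq
          (Measure.addHaar_ball_center _ _ _)
      obtain ⟨z, hz⟩ := lt_iSup_iff.1 (ENNReal.half_lt_self h0 hst)
      refine ⟨z, fun y => (hle y).trans ?_⟩
      rw [mul_comm, ← ENNReal.div_le_iff_le_mul (Or.inl two_ne_zero) (Or.inl ENNReal.ofNat_ne_top)]
      exact hz.le
  choose next hnext using hnext
  let U : ℕ → Set (Space d) := fun i => Nat.rec ∅ (fun _ V => V ∪ ball (next V) 1) i
  have hUs : ∀ i, U (i + 1) = U i ∪ ball (next (U i)) 1 := fun i => rfl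
  have hU : ∀ i, U i = ⋃ l < i, ball (next (U l)) 1 := by
    intro i
    induction i with
    | zero => simp [U]
    | succ i ih => rw [biUnion_lt_succ, ← ih, hUs]
  have hUm : ∀ i, MeasurableSet (U i) := fun i => by
    rw [hU]
    exact MeasurableSet.iUnion fun l => MeasurableSet.iUnion fun _ => measurableSet_ball
  -- Each step captures at least half of what any ball `ball y 1` still holds, and the remainders
  -- decrease, so the mass captured in `i` steps dominates `i / 2` times the current remainder.
  have key : ∀ (i : ℕ) (y : Space d),
      (i : ℝ≥0∞) * volume ((A ∩ ball y 1) \ U i) ≤ 2 * volume (A ∩ U i) := by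
    intro i
    induction i with
    | zero => simp
    | succ i ih =>
      intro y
      have h1 : volume ((A ∩ ball y 1) \ U (i + 1)) ≤ volume ((A ∩ ball y 1) \ U i) :=
        measure_mono (sdiff_subset_sdiff_right (by rw [hUs]; exact subset_union_left))
      have h2 : volume (A ∩ U i) + volume ((A ∩ ball (next (U i)) 1) \ U i) =
          volume (A ∩ U (i + 1)) := by
        rw [← measure_inter_add_sdiff (A ∩ U (i + 1)) (hUm i), hUs]
        congr 2
        · ext z; simp only [mem_inter_iff, mem_union]; tauto
        · ext z; simp only [mem_inter_iff, mem_union, Set.mem_sdiff]; tauto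
      calc ((i + 1 : ℕ) : ℝ≥0∞) * volume ((A ∩ ball y 1) \ U (i + 1))
          ≤ ((i + 1 : ℕ) : ℝ≥0∞) * volume ((A ∩ ball y 1) \ U i) := by gcongr
        _ = i * volume ((A ∩ ball y 1) \ U i) + volume ((A ∩ ball y 1) \ U i) := by
          push_cast; ring
        _ ≤ 2 * volume (A ∩ U i) + 2 * volume ((A ∩ ball (next (U i)) 1) \ U i) :=
          add_le_add (ih y) (hnext _ y)
        _ = 2 * volume (A ∩ U (i + 1)) := by rw [← mul_add, h2]
  refine ⟨fun i => next (U i), fun i y => ?_⟩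
  rw [← hU]
  exact (key i y).trans (by gcongr; exact inter_subset_left)

/-- Around a point outside the doubled balls, the ball of radius `r ≤ 1` misses all the greedy unit
balls. The greedy bound and the size of `i` then force density at most 1/2 there. -/
theorem volume_diff_greedy_balls_le {d : ℕ} {A G : Set (Space d)} (hG : MeasurableSet G)
    (hGA : G ⊆ A) {x : ℕ → Space d}
    (hx : ∀ (i : ℕ) (y : Space d),
      (i : ℝ≥0∞) * volume ((A ∩ ball y 1) \ ⋃ l < i, ball (x l) 1) ≤ 2 * volume A)
    {r : ℝ} (hr : 0 < r) (hr1 : r ≤ 1) {c : ℝ≥0∞}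
    (hc : ∀ h ∈ ball (0 : Space d) r, volume (shiftDiff G h) ≤ c) {i : ℕ} (hi : i ≠ 0)
    (hiA : 4 * volume A ≤ i * volume (ball (0 : Space d) r)) :
    volume (G \ ⋃ l < i, ball (x l) 2) ≤ 2 * c := by
  refine volume_le_of_density_le_half hG sdiff_subset hr hc fun y hy => ?_
  have hsub : G ∩ ball y r ⊆ (A ∩ ball y 1) \ ⋃ l < i, ball (x l) 1 := by
    rintro z ⟨hzG, hzy⟩
    refine ⟨⟨hGA hzG, ball_subset_ball hr1 hzy⟩, fun hz => hy.2 ?_⟩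
    simp only [mem_iUnion] at hz ⊢
    obtain ⟨l, hl, hzl⟩ := hz
    refine ⟨l, hl, ?_⟩
    rw [mem_ball] at *
    rw [dist_comm] at hzy
    linarith [dist_triangle y z (x l)]
  have hi0 : (i : ℝ≥0∞) ≠ 0 := by exact_mod_cast hi
  refine (ENNReal.mul_le_mul_iff_right hi0 (ENNReal.natCast_ne_top i)).1 ?_
  calc (i : ℝ≥0∞) * (2 * volume (G ∩ ball y r)) = 2 * (i * volume (G ∩ ball y r)) := by ring
    _ ≤ 2 * (2 * volume A) := by
      exact mul_le_mul' le_rfl ((mul_le_mul' le_rfl (measure_mono hsub)).trans (hx i y))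
    _ = 4 * volume A := by ring
    _ ≤ _ := hiA

/-! ### Moving frames and mass balance -/

theorem translateSub_eq_preimage {d N : ℕ} (E : Fin N → Set (Space d)) (v : Space d) (j : Fin N) :
    translateSub E v j = (fun y => y + v) ⁻¹' E j := by
  ext y
  constructor
  · rintro ⟨z, hz, rfl⟩
    simpa using hz
  · exact fun h => ⟨y + v, h, by simp⟩

theorem HasShiftBound.preimage_add {d : ℕ} {C : ℝ≥0∞} {G : Set (Space d)}
    (hG : HasShiftBound C G) (v : Space d) : HasShiftBound C ((fun y => y + v) ⁻¹' G) := by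
  intro x₀ h hh
  refine le_trans (le_of_eq ?_) (hG (x₀ + v) h hh)
  rw [← measure_preimage_add_right volume v (ball (x₀ + v) (1 / 4) ∩ shiftDiff G h)]
  congr 1
  ext y
  simp [shiftDiff, add_right_comm]

theorem volume_preimage_add_inter_ball {d : ℕ} (G : Set (Space d)) (v : Space d) (R : ℝ) :
    volume (((fun y => y + v) ⁻¹' G) ∩ ball 0 R) = volume (G ∩ ball v R) := by
  rw [← measure_preimage_add_right volume v (G ∩ ball v R)]
  congr 1
  ext y
  simp [dist_eq_norm]

/-- Compactness along countably many moving frames: after extraction, all translated tuples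
converge locally in measure and all mutual distances of the frames converge in `[0, ∞]`. -/
theorem exists_subseq_frames {d N : ℕ} {ι : Type*} [Countable ι]
    {E : ℕ → Fin N → Set (Space d)} (hE : ∀ n j, MeasurableSet (E n j)) {C : ℝ≥0∞}
    (hC : C ≠ ∞) (hEC : ∀ n j, HasShiftBound C (E n j)) (p : ℕ → ι → Space d) :
    ∃ (φ : ℕ → ℕ) (F : ι → Fin N → Set (Space d)) (L : ι → ι → ℝ≥0∞), StrictMono φ ∧
      (∀ i j, MeasurableSet (F i j)) ∧
      (∀ i j, ∀ R : ℝ, Tendsto (fun n => volume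
        (symmDiff ((fun y => y + p (φ n) i) ⁻¹' E (φ n) j) (F i j) ∩ ball 0 R)) atTop (𝓝 0)) ∧
      (∀ i i', Tendsto (fun n => edist (p (φ n) i) (p (φ n) i')) atTop (𝓝 (L i i'))) := by
  -- All averages and all mutual distances are gathered in one point of a countable product of
  -- copies of `[0, ∞]`, so sequential compactness replaces a diagonal argument and allows infinite
  -- limit distances.
  let u : ℕ → (ι × Fin N × ℕ × ℕ) ⊕ (ι × ι) → ℝ≥0∞ := fun n =>
    Sum.elim (fun q => volume (((fun y => y + p n q.1) ⁻¹' E n q.2.1) ∩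
      ball (TopologicalSpace.denseSeq (Space d) q.2.2.2) (1 / (q.2.2.1 + 4 : ℝ))))
      (fun q => edist (p n q.1) (p n q.2))
  obtain ⟨a, φ, hφ, ha⟩ := CompactSpace.tendsto_subseq u
  rw [tendsto_pi_nhds] at ha
  have hex : ∀ i j, ∃ F : Set (Space d), MeasurableSet F ∧ ∀ R : ℝ, Tendsto (fun n => volume
      (symmDiff ((fun y => y + p (φ n) i) ⁻¹' E (φ n) j) F ∩ ball 0 R)) atTop (𝓝 0) := by
    intro i j
    refine exists_limit_of_hasShiftBound (fun n => measurable_add_const _ (hE _ j)) hC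
      (fun n => (hEC _ j).preimage_add _) fun k q => ?_
    exact ⟨_, ha (Sum.inl (i, j, k, q))⟩
  choose F hFm hF using hex
  exact ⟨φ, F, fun i i' => a (Sum.inr (i, i')), hφ, hFm, hF, fun i i' => ha (Sum.inr (i, i'))⟩

theorem volume_inter_le_add_symmDiff {d : ℕ} (G F B : Set (Space d)) :
    volume (G ∩ B) ≤ volume (F ∩ B) + volume (symmDiff G F ∩ B) := by
  refine (measure_mono ?_).trans (measure_union_le _ _)
  rintro x ⟨hx, hB⟩
  by_cases h : x ∈ F
  · exact Or.inl ⟨h, hB⟩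
  · exact Or.inr ⟨Or.inl ⟨hx, h⟩, hB⟩

/-- Balls of a fixed radius around finitely many diverging centres are eventually disjoint, so the
masses seen in them add up to at most the total; the radius is sent to infinity last. -/
theorem sum_volume_le_liminf {d : ℕ} {κ : Type*} {p : ℕ → κ → Space d} {G : ℕ → Set (Space d)}
    {F : κ → Set (Space d)} (hG : ∀ n, MeasurableSet (G n))
    (hsep : ∀ k k', k ≠ k' → Tendsto (fun n => edist (p n k) (p n k')) atTop (𝓝 ∞))
    (hF : ∀ k, ∀ R : ℝ, Tendsto (fun n => volume
      (symmDiff ((fun y => y + p n k) ⁻¹' G n) (F k) ∩ ball 0 R)) atTop (𝓝 0))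
    (S : Finset κ) : ∑ k ∈ S, volume (F k) ≤ liminf (fun n => volume (G n)) atTop := by
  have hR : ∀ m : ℕ, ∑ k ∈ S, volume (F k ∩ ball 0 (m : ℝ)) ≤
      liminf (fun n => volume (G n)) atTop := by
    intro m
    let δ : ℕ → ℝ≥0∞ := fun n => ∑ k ∈ S, volume
      (symmDiff ((fun y => y + p n k) ⁻¹' G n) (F k) ∩ ball 0 (m : ℝ))
    have hδ : Tendsto δ atTop (𝓝 0) := by
      simpa using tendsto_finsetSum S fun k _ => hF k m
    have hlim : Tendsto (fun n => ∑ k ∈ S, volume (F k ∩ ball 0 (m : ℝ)) - δ n) atTop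
        (𝓝 (∑ k ∈ S, volume (F k ∩ ball 0 (m : ℝ)))) := by
      have := ENNReal.Tendsto.sub (tendsto_const_nhds
        (x := ∑ k ∈ S, volume (F k ∩ ball 0 (m : ℝ)))) hδ (Or.inr ENNReal.zero_ne_top)
      simpa using this
    rw [← hlim.liminf_eq]
    refine liminf_le_liminf ?_
    have hdisj : ∀ᶠ n in atTop, ∀ k ∈ S, ∀ k' ∈ S, k ≠ k' →
        ENNReal.ofReal (m + m) < edist (p n k) (p n k') := by
      rw [eventually_all_finset]
      intro k _
      rw [eventually_all_finset]
      intro k' _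
      rw [eventually_imp_distrib_left]
      exact fun hk => (hsep k k' hk).eventually_const_lt ENNReal.ofReal_lt_top
    filter_upwards [hdisj] with n hn
    rw [tsub_le_iff_right]
    calc ∑ k ∈ S, volume (F k ∩ ball 0 (m : ℝ))
        ≤ ∑ k ∈ S, (volume (G n ∩ ball (p n k) m) + volume
          (symmDiff ((fun y => y + p n k) ⁻¹' G n) (F k) ∩ ball 0 (m : ℝ))) := by
          refine Finset.sum_le_sum fun k _ => ?_
          have h1 := volume_inter_le_add_symmDiff (F k) ((fun y => y + p n k) ⁻¹' G n)
            (ball 0 (m : ℝ))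
          rwa [symmDiff_comm, volume_preimage_add_inter_ball] at h1
      _ = volume (⋃ k ∈ S, G n ∩ ball (p n k) m) + δ n := by
          rw [Finset.sum_add_distrib, measure_biUnion_finset]
          · intro k hk k' hk' hkk
            refine (ball_disjoint_ball ?_).mono inter_subset_right inter_subset_right
            have h1 := hn k hk k' hk' hkk
            rw [edist_dist] at h1
            exact ((ENNReal.ofReal_lt_ofReal_iff_of_nonneg (by positivity)).1 h1).le
          · exact fun k _ => (hG n).inter measurableSet_ball
      _ ≤ volume (G n) + δ n := by
          gcongr
          exact iUnion₂_subset fun k _ => inter_subset_left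
  have hmono : ∀ k, Tendsto (fun m : ℕ => volume (F k ∩ ball 0 (m : ℝ))) atTop
      (𝓝 (volume (F k))) := by
    intro k
    have h1 : Monotone fun m : ℕ => F k ∩ ball 0 (m : ℝ) := fun a b hab =>
      inter_subset_inter_right _ (ball_subset_ball (by exact_mod_cast hab))
    have h2 := tendsto_measure_iUnion_atTop (μ := volume) h1
    rwa [← inter_iUnion, iUnion_ball_nat, inter_univ] at h2
  exact le_of_tendsto' (tendsto_finsetSum S fun k _ => hmono k) hR

/-- The finitely many balls that carry almost all the mass lie, eventually, in balls of one fixed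
radius around representatives, where local convergence applies. Frames sharing a chosen
representative are counted once, because `S` is an image. -/
theorem limsup_volume_le_tsum {d : ℕ} {ι κ : Type*} {p : ℕ → ι → Space d}
    {G : ℕ → Set (Space d)} {F : ι → Set (Space d)} {rep : κ → ι}
    (hrep : ∀ i, ∃ k, ∃ l, l < ∞ ∧ Tendsto (fun n => edist (p n i) (p n (rep k))) atTop (𝓝 l))
    (hF : ∀ i, ∀ R : ℝ, Tendsto (fun n => volume
      (symmDiff ((fun y => y + p n i) ⁻¹' G n) (F i) ∩ ball 0 R)) atTop (𝓝 0))
    (htight : ∀ ε : ℝ≥0∞, 0 < ε → ∃ T : Finset ι, ∀ᶠ n in atTop,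
      volume (G n \ ⋃ i ∈ T, ball (p n i) 2) ≤ ε) :
    limsup (fun n => volume (G n)) atTop ≤ ∑' k, volume (F (rep k)) := by
  classical
  refine ENNReal.le_of_forall_pos_le_add fun ε hε _ => ?_
  obtain ⟨T, hT⟩ := htight ε (by exact_mod_cast hε)
  choose κ' l hl hκ using hrep
  let S : Finset κ := T.image κ'
  -- The `+ 1` makes `M` strictly larger than every limiting distance, so the actual distances are
  -- eventually below it; `R` adds the radius 2 of the balls.
  let M : ℝ≥0∞ := ∑ i ∈ T, l i + 1
  have hM : M ≠ ∞ := ENNReal.add_ne_top.2 ⟨(ENNReal.sum_lt_top.2 fun i _ => hl i).ne,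
    ENNReal.one_ne_top⟩
  let R : ℝ := M.toReal + 2
  have hnear : ∀ᶠ n in atTop, ∀ i ∈ T, edist (p n i) (p n (rep (κ' i))) < M := by
    rw [eventually_all_finset]
    intro i hi
    refine (hκ i).eventually (gt_mem_nhds ?_)
    refine (Finset.single_le_sum (f := l) (fun _ _ => zero_le) hi).trans_lt ?_
    exact ENNReal.lt_add_right (ENNReal.sum_lt_top.2 fun i _ => hl i).ne one_ne_zero
  let δ : ℕ → ℝ≥0∞ := fun n => ∑ k ∈ S, volume
    (symmDiff ((fun y => y + p n (rep k)) ⁻¹' G n) (F (rep k)) ∩ ball 0 R)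
  have hδ : Tendsto δ atTop (𝓝 0) := by
    simpa using tendsto_finsetSum S fun k _ => hF (rep k) R
  have hlim : Tendsto (fun n => ∑ k ∈ S, volume (F (rep k)) + δ n + ε) atTop
      (𝓝 (∑ k ∈ S, volume (F (rep k)) + 0 + ε)) := (hδ.const_add _).add_const _
  have hle : ∀ᶠ n in atTop, volume (G n) ≤ ∑ k ∈ S, volume (F (rep k)) + δ n + ε := by
    filter_upwards [hT, hnear] with n hTn hn
    have hsub : G n ⊆ (⋃ k ∈ S, G n ∩ ball (p n (rep k)) R) ∪
        (G n \ ⋃ i ∈ T, ball (p n i) 2) := by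
      intro y hy
      by_cases hyT : y ∈ ⋃ i ∈ T, ball (p n i) 2
      · left
        obtain ⟨i, hi, hyi⟩ := mem_iUnion₂.1 hyT
        refine mem_iUnion₂.2 ⟨κ' i, Finset.mem_image_of_mem _ hi, hy, ?_⟩
        have h1 := hn i hi
        rw [edist_dist, ENNReal.ofReal_lt_iff_lt_toReal dist_nonneg hM] at h1
        rw [mem_ball] at hyi ⊢
        linarith [dist_triangle y (p n i) (p n (rep (κ' i)))]
      · exact Or.inr ⟨hy, hyT⟩
    refine (measure_mono hsub).trans ((measure_union_le _ _).trans (add_le_add ?_ hTn))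
    refine (measure_biUnion_finset_le S _).trans ?_
    rw [← Finset.sum_add_distrib]
    refine Finset.sum_le_sum fun k _ => ?_
    rw [← volume_preimage_add_inter_ball]
    refine (volume_inter_le_add_symmDiff _ (F (rep k)) _).trans ?_
    gcongr
    exact inter_subset_left
  calc limsup (fun n => volume (G n)) atTop
      ≤ ∑ k ∈ S, volume (F (rep k)) + 0 + ε := by
        rw [← hlim.limsup_eq]
        exact limsup_le_limsup hle
    _ ≤ _ := by
        rw [add_zero]
        gcongr
        exact ENNReal.sum_le_tsum S

/-! ### Stability of partitions -/

theorem volume_eq_zero_of_inter_ball {d : ℕ} {A : Set (Space d)}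
    (h : ∀ R : ℝ, volume (A ∩ ball 0 R) = 0) : volume A = 0 := by
  rw [← inter_univ A, ← iUnion_ball_nat (0 : Space d), inter_iUnion]
  exact measure_iUnion_null fun m => h m

theorem IsPartition.of_tendsto {d N : ℕ} {G : ℕ → Fin N → Set (Space d)}
    (hG : ∀ n, IsPartition (G n)) {F : Fin N → Set (Space d)} (hF : ∀ j, MeasurableSet (F j))
    (h : ∀ j, ∀ R : ℝ, Tendsto (fun n => volume (symmDiff (G n j) (F j) ∩ ball 0 R)) atTop
      (𝓝 0)) : IsPartition F where
  measurable j := (hF j).nullMeasurableSet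
  inter_null j k hjk := by
    refine volume_eq_zero_of_inter_ball fun R => ?_
    have hlim := (h j R).add (h k R)
    rw [add_zero] at hlim
    refine le_antisymm (ge_of_tendsto' hlim fun n => ?_) zero_le
    have hsub : F j ∩ F k ∩ ball 0 R ⊆ (G n j ∩ G n k) ∪
        ((symmDiff (G n j) (F j) ∩ ball 0 R) ∪ (symmDiff (G n k) (F k) ∩ ball 0 R)) := by
      rintro x ⟨⟨hj, hk⟩, hR⟩
      simp only [mem_union, mem_inter_iff, mem_symmDiff]
      tauto
    refine (measure_mono hsub).trans ((measure_union_le _ _).trans ?_)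
    rw [(hG n).inter_null j k hjk, zero_add]
    exact measure_union_le _ _
  cover := by
    refine volume_eq_zero_of_inter_ball fun R => ?_
    have hlim := tendsto_finsetSum Finset.univ fun j _ => h j R
    rw [Finset.sum_const_zero] at hlim
    refine le_antisymm (ge_of_tendsto' hlim fun n => ?_) zero_le
    have hsub : (⋃ j, F j)ᶜ ∩ ball 0 R ⊆ (⋃ j, G n j)ᶜ ∪
        ⋃ j ∈ Finset.univ, (symmDiff (G n j) (F j) ∩ ball 0 R) := by
      rintro x ⟨hx, hR⟩
      by_cases hxG : x ∈ ⋃ j, G n j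
      · obtain ⟨j, hj⟩ := mem_iUnion.1 hxG
        refine Or.inr (mem_iUnion₂.2 ⟨j, Finset.mem_univ j, Or.inl ⟨hj, fun hxF => ?_⟩, hR⟩)
        exact hx (mem_iUnion.2 ⟨j, hxF⟩)
      · exact Or.inl hxG
    refine (measure_mono hsub).trans ((measure_union_le _ _).trans ?_)
    rw [(hG n).cover, zero_add]
    exact measure_biUnion_finset_le _ _

theorem IsPartition.congr {d N : ℕ} {E E' : Fin N → Set (Space d)} (hE : IsPartition E)
    (h : ∀ j, E' j =ᵐ[volume] E j) : IsPartition E' where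
  measurable j := (hE.measurable j).congr (h j).symm
  inter_null j k hjk := by
    rw [measure_congr ((h j).inter (h k))]
    exact hE.inter_null j k hjk
  cover := by
    rw [measure_congr (Filter.EventuallyEq.countable_iUnion h).compl]
    exact hE.cover

theorem IsPartition.preimage_add {d N : ℕ} {E : Fin N → Set (Space d)} (hE : IsPartition E)
    (v : Space d) : IsPartition fun j => (fun y => y + v) ⁻¹' E j where
  measurable j := (hE.measurable j).preimage
    (measurePreserving_add_right volume v).quasiMeasurePreserving
  inter_null j k hjk := by
    rw [← preimage_inter, measure_preimage_add_right]
    exact hE.inter_null j k hjk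
  cover := by
    rw [← preimage_iUnion, ← preimage_compl, measure_preimage_add_right]
    exact hE.cover

theorem openVariation_congr {d : ℕ} {E E' : Set (Space d)} (h : E' =ᵐ[volume] E)
    (U : Set (Space d)) : openVariation E' U = openVariation E U := by
  simp only [openVariation, setIntegral_congr_set h]

theorem perimeter_le_two_mul_partitionPerimeter {d N : ℕ} (E : Fin N → Set (Space d))
    (B : Set (Space d)) (j : Fin N) : perimeter (E j) B ≤ 2 * partitionPerimeter E B := by
  rw [partitionPerimeter, ENNReal.mul_div_cancel two_ne_zero ENNReal.ofNat_ne_top]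
  exact Finset.single_le_sum (f := fun j => perimeter (E j) B) (fun _ _ => zero_le)
    (Finset.mem_univ j)

theorem hasShiftBound_of_partitionPerimeter_le {d N : ℕ} {E : Fin N → Set (Space d)}
    (hE : ∀ j, MeasurableSet (E j)) {C : ℝ≥0∞}
    (h : ∀ x, partitionPerimeter E (ball x 1) ≤ C) (j : Fin N) : HasShiftBound (2 * C) (E j) := by
  intro x₀ h' hh'
  refine (volume_ball_quarter_inter_shiftDiff_le (hE j) x₀ hh').trans ?_
  rw [← perimeter_of_isOpen _ isOpen_ball]
  gcongr
  exact (perimeter_le_two_mul_partitionPerimeter E _ j).trans (by gcongr; exact h x₀)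

/-! ### Tightness and selection of frames -/

/-- Regions of bounded volume and bounded perimeter are captured, up to a small volume and
uniformly in `n`, by finitely many of the balls of radius `2` around greedy centers. -/
theorem exists_eventually_volume_diff_balls_le {d : ℕ} {A G : ℕ → Set (Space d)}
    (hG : ∀ n, MeasurableSet (G n)) (hGA : ∀ n, G n ⊆ A n) {x : ℕ → ℕ → Space d}
    (hx : ∀ (n i : ℕ) (y : Space d),
      (i : ℝ≥0∞) * volume ((A n ∩ ball y 1) \ ⋃ l < i, ball (x n l) 1) ≤ 2 * volume (A n))
    {M P : ℝ≥0∞} (hM : M ≠ ∞) (hP : P ≠ ∞) (hA : ∀ᶠ n in atTop, volume (A n) ≤ M)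
    (hGP : ∀ n, openVariation (G n) univ ≤ P) {ε : ℝ≥0∞} (hε : 0 < ε) :
    ∃ i : ℕ, ∀ᶠ n in atTop, volume (G n \ ⋃ l < i, ball (x n l) 2) ≤ ε := by
  -- The scale `r` is chosen from `P` and `ε`, then the number `i` of balls from `M` and `r`;
  -- neither depends on `n`.
  obtain ⟨k, hk⟩ := ((tendsto_two_mul_ofReal_mul hP).eventually (ge_mem_nhds hε)).exists
  set r : ℝ := 1 / (k + 4 : ℝ) with hr
  have hrpos : 0 < r := by positivity
  have hr1 : r ≤ 1 := by
    rw [hr, div_le_one (by positivity)]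
    linarith [Nat.cast_nonneg (α := ℝ) k]
  have hv0 : volume (ball (0 : Space d) r) ≠ 0 := (measure_ball_pos _ _ hrpos).ne'
  obtain ⟨i, hi⟩ := ENNReal.exists_nat_mul_gt hv0
    (ENNReal.mul_ne_top (ENNReal.ofNat_ne_top (n := 4)) hM)
  have hi0 : i ≠ 0 := by
    rintro rfl
    simp at hi
  refine ⟨i, ?_⟩
  filter_upwards [hA] with n hn
  refine le_trans ?_ hk
  refine volume_diff_greedy_balls_le (hG n) (hGA n) (hx n) hrpos hr1 (fun h hh => ?_) hi0
    (le_trans (by gcongr) hi.le)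
  rw [mem_ball_zero_iff] at hh
  exact (volume_shiftDiff_le (hG n) h).trans
    (mul_le_mul' (ENNReal.ofReal_le_ofReal hh.le) (hGP n))

/-- Compactness for moving frames which contain, for the regions of bounded volume, almost all
of the mass, after selection of one frame in each class of frames at bounded distance. -/
theorem exists_separated_frames {d N : ℕ} {E : ℕ → Fin N → Set (Space d)}
    (hE : ∀ n j, MeasurableSet (E n j)) {C : ℝ≥0∞} (hC : C ≠ ∞)
    (hEC : ∀ n j, HasShiftBound C (E n j)) {ι : Type*} [Countable ι] (p : ℕ → ι → Space d)
    (y : ℕ → ι)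
    (hy : ∀ a b, a ≠ b → Tendsto (fun n => edist (p n (y a)) (p n (y b))) atTop (𝓝 ∞)) :
    ∃ (φ : ℕ → ℕ) (F : ℕ → Fin N → Set (Space d)) (x : ℕ → ℕ → Space d), StrictMono φ ∧
      (∀ i j, MeasurableSet (F i j)) ∧
      (∀ i i', i ≠ i' → Tendsto (fun n => edist (x n i) (x n i')) atTop (𝓝 ∞)) ∧
      (∀ i j, ∀ R : ℝ, Tendsto (fun n => volume
        (symmDiff ((fun y => y + x n i) ⁻¹' E (φ n) j) (F i j) ∩ ball 0 R)) atTop (𝓝 0)) ∧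
      ∀ j, (∀ ε : ℝ≥0∞, 0 < ε → ∃ T : Finset ι, ∀ᶠ n in atTop,
        volume (E n j \ ⋃ i ∈ T, ball (p n i) 2) ≤ ε) →
        Tendsto (fun n => volume (E (φ n) j)) atTop (𝓝 (∑' i, volume (F i j))) := by
  obtain ⟨φ, F, L, hφ, hFm, hF, hL⟩ := exists_subseq_frames hE hC hEC p
  have hLself : ∀ i, L i i = 0 := fun i =>
    tendsto_nhds_unique (hL i i) (by simp)
  have hLcomm : ∀ i i', L i i' = L i' i := fun i i' =>
    tendsto_nhds_unique (hL i i') (by simpa only [edist_comm] using hL i' i)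
  have hLtri : ∀ i i' i'', L i i'' ≤ L i i' + L i' i'' := fun i i' i'' =>
    le_of_tendsto_of_tendsto' (hL i i'') ((hL i i').add (hL i' i'')) fun n =>
      edist_triangle _ _ _
  -- Finite limiting distance is an equivalence relation because the limits satisfy the triangle
  -- inequality. The frames `y` lie in distinct classes, so the countable quotient is infinite and
  -- can be enumerated by `ℕ`.
  let s : Setoid ι :=
    { r := fun i i' => L i i' < ∞
      iseqv := ⟨fun i => by simp [hLself], fun {i i'} h => by rwa [hLcomm],
        fun {i i' i''} h h' => (hLtri i i' i'').trans_lt (ENNReal.add_lt_top.2 ⟨h, h'⟩)⟩ }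
  have hinj : Function.Injective fun a : ℕ => (Quotient.mk s (y a)) := by
    intro a b hab
    by_contra hne
    have h1 : L (y a) (y b) < ∞ := Quotient.exact hab
    exact h1.ne (tendsto_nhds_unique (hL _ _) ((hy a b hne).comp hφ.tendsto_atTop))
  have : Infinite (Quotient s) := Infinite.of_injective _ hinj
  obtain ⟨σ⟩ := nonempty_equiv_of_countable (α := ℕ) (β := Quotient s)
  let rep : ℕ → ι := fun k => (σ k).out
  have hsep : ∀ k k', k ≠ k' →
      Tendsto (fun n => edist (p (φ n) (rep k)) (p (φ n) (rep k'))) atTop (𝓝 ∞) := by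
    intro k k' hk
    have h1 : L (rep k) (rep k') = ∞ := by
      by_contra hne
      have h2 : Quotient.mk s (rep k) = Quotient.mk s (rep k') :=
        Quotient.sound (show L (rep k) (rep k') < ∞ from Ne.lt_top hne)
      rw [Quotient.out_eq, Quotient.out_eq] at h2
      exact hk (σ.injective h2)
    rw [← h1]
    exact hL _ _
  refine ⟨φ, fun k => F (rep k), fun n k => p (φ n) (rep k), hφ, fun k => hFm _, hsep,
    fun k => hF _, fun j hj => ?_⟩
  have hrep : ∀ i, ∃ k, ∃ l, l < ∞ ∧
      Tendsto (fun n => edist (p (φ n) i) (p (φ n) (rep k))) atTop (𝓝 l) := by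
    intro i
    refine ⟨σ.symm (Quotient.mk s i), _, ?_, hL _ _⟩
    have h1 : L (rep (σ.symm (Quotient.mk s i))) i < ∞ := by
      simp only [rep, Equiv.apply_symm_apply]
      exact Quotient.mk_out (s := s) i
    rwa [hLcomm]
  refine tendsto_of_le_liminf_of_limsup_le ?_ ?_
  · rw [ENNReal.tsum_eq_iSup_sum]
    exact iSup_le fun S => sum_volume_le_liminf (fun n => hE (φ n) j) hsep
      (fun k => hF (rep k) j) S
  · refine limsup_volume_le_tsum (p := fun n => p (φ n)) (F := fun i => F i j) hrep
      (fun i => hF i j) fun ε hε => ?_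
    obtain ⟨T, hT⟩ := hj ε hε
    exact ⟨T, hφ.tendsto_atTop.eventually hT⟩

/-- Supplies infinitely many frames even when the mass concentrates in finitely many places. This
needs `1 ≤ d`: in dimension 0 there is a single point. -/
theorem exists_pairwise_diverging {d : ℕ} (hd : 1 ≤ d) :
    ∃ y : ℕ → ℕ → Space d, ∀ a b, a ≠ b →
      Tendsto (fun n => edist (y n a) (y n b)) atTop (𝓝 ∞) := by
  refine ⟨fun n a => EuclideanSpace.single ⟨0, hd⟩ ((n : ℝ) * a), fun a b hab => ?_⟩
  simp only [edist_dist]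
  rw [ENNReal.tendsto_ofReal_nhds_top]
  have hpos : (0 : ℝ) < |(a : ℝ) - b| := abs_pos.2 (sub_ne_zero.2 (by exact_mod_cast hab))
  refine (tendsto_natCast_atTop_atTop.atTop_mul_const hpos).congr fun n => ?_
  rw [PiLp.dist_single_same, Real.dist_eq, ← mul_sub, abs_mul, Nat.abs_cast]

theorem tendstoL1Loc_of_ball {d N : ℕ} {E : ℕ → Fin N → Set (Space d)} {F : Fin N → Set (Space d)}
    (h : ∀ j, ∀ R : ℝ, Tendsto (fun n => volume (symmDiff (E n j) (F j) ∩ ball 0 R)) atTop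
      (𝓝 0)) : TendstoL1Loc E F := by
  intro B _ hB j
  obtain ⟨R, hR⟩ := hB.subset_ball 0
  exact tendsto_of_tendsto_of_tendsto_of_le_of_le tendsto_const_nhds (h j R)
    (fun _ => zero_le) fun n => measure_mono (inter_subset_inter_right _ hR)

end PartitionCompactness

theorem theorem3p1 (d N : ℕ) (hd : 1 ≤ d)
    (E : ℕ → Fin N → Set (PartitionCompactness.Space d))
    (hE : ∀ n, PartitionCompactness.IsPartition (E n))
    (m : Fin N → ℝ≥0∞)
    (hm : ∀ j, m j = limsup (fun n => volume (E n j)) atTop)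
    (hloc : (⨆ (x : PartitionCompactness.Space d) (n : ℕ),
      PartitionCompactness.partitionPerimeter (E n) (Metric.ball x 1)) < ⊤)
    (hper : ∀ j, m j < ⊤ →
      (⨆ n : ℕ, PartitionCompactness.perimeter (E n j) Set.univ) < ⊤) :
    ∃ (φ : ℕ → ℕ) (F : ℕ → Fin N → Set (PartitionCompactness.Space d))
      (x : ℕ → ℕ → PartitionCompactness.Space d),
      StrictMono φ ∧
      (∀ i, PartitionCompactness.IsPartition (F i)) ∧
      (∀ i i', i ≠ i' → Tendsto (fun n => ‖x n i - x n i'‖) atTop atTop) ∧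
      (∀ i, PartitionCompactness.TendstoL1Loc
        (fun n => PartitionCompactness.translateSub (E (φ n)) (x n i)) (F i)) ∧
      (∀ j, m j < ⊤ →
        Tendsto (fun n => volume (E (φ n) j)) atTop (𝓝 (∑' i, volume (F i j)))) := by
  classical
  -- The regions are only null measurable; measurable representatives keep volumes, perimeters and
  -- limits.
  let E' : ℕ → Fin N → Set (PartitionCompactness.Space d) := fun n j => toMeasurable volume (E n j)
  have hae : ∀ n j, E' n j =ᵐ[volume] E n j := fun n j =>
    ((hE n).measurable j).toMeasurable_ae_eq
  have hE'm : ∀ n j, MeasurableSet (E' n j) := fun n j => measurableSet_toMeasurable _ _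
  have hE'p : ∀ n, PartitionCompactness.IsPartition (E' n) := fun n => (hE n).congr (hae n)
  have hvol : ∀ n j, volume (E' n j) = volume (E n j) := fun n j => measure_toMeasurable _
  have hpercongr : ∀ n j B, PartitionCompactness.perimeter (E' n j) B = PartitionCompactness.perimeter (E n j) B := by
    intro n j B
    simp only [PartitionCompactness.perimeter, PartitionCompactness.openVariation_congr (hae n j)]
  set C := ⨆ (x : PartitionCompactness.Space d) (n : ℕ), PartitionCompactness.partitionPerimeter (E n) (Metric.ball x 1) with hCdef
  have hEC : ∀ n j, PartitionCompactness.HasShiftBound (2 * C) (E' n j) := by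
    intro n
    refine PartitionCompactness.hasShiftBound_of_partitionPerimeter_le (hE'm n) fun x => ?_
    have h1 : PartitionCompactness.partitionPerimeter (E' n) (Metric.ball x 1) =
        PartitionCompactness.partitionPerimeter (E n) (Metric.ball x 1) := by
      simp only [PartitionCompactness.partitionPerimeter, hpercongr]
    rw [h1]
    exact le_iSup₂ (f := fun (x : PartitionCompactness.Space d) (n : ℕ) =>
      PartitionCompactness.partitionPerimeter (E n) (Metric.ball x 1)) x n
  let J : Finset (Fin N) := Finset.univ.filter fun j => m j < ∞
  -- Greedy centres of the union serve all regions of finite `m j` simultaneously, so the frames do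
  -- not depend on `j`.
  let A : ℕ → Set (PartitionCompactness.Space d) := fun n => ⋃ j ∈ J, E' n j
  choose c hc using fun n => PartitionCompactness.exists_greedy_centers (A n)
  obtain ⟨y, hy⟩ := PartitionCompactness.exists_pairwise_diverging hd
  obtain ⟨φ, F, x, hφ, hFm, hsep, hconv, hmass⟩ := PartitionCompactness.exists_separated_frames hE'm
    (ENNReal.mul_ne_top ENNReal.ofNat_ne_top hloc.ne) hEC
    (fun n => Sum.elim (c n) (y n)) Sum.inr hy
  refine ⟨φ, F, x, hφ, fun i => ?_, fun i i' hi => ?_, fun i => ?_, fun j hj => ?_⟩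
  · exact PartitionCompactness.IsPartition.of_tendsto (fun n => (hE'p (φ n)).preimage_add (x n i)) (hFm i) (hconv i)
  · have h1 := hsep i i' hi
    simp only [edist_dist, dist_eq_norm] at h1
    exact ENNReal.tendsto_ofReal_nhds_top.1 h1
  · refine PartitionCompactness.tendstoL1Loc_of_ball fun j R => (hconv i j R).congr fun n => ?_
    refine measure_congr (EventuallyEq.inter ?_ EventuallyEq.rfl)
    have h1 : (fun y => y + x n i) ⁻¹' E' (φ n) j =ᵐ[volume]
        (fun y => y + x n i) ⁻¹' E (φ n) j :=
      (measurePreserving_add_right volume (x n i)).quasiMeasurePreserving.preimage_ae_eq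
        (hae _ j)
    rw [PartitionCompactness.translateSub_eq_preimage]
    exact (h1.diff EventuallyEq.rfl).union (EventuallyEq.rfl.diff h1)
  · simp only [← hvol]
    refine hmass j fun ε hε => ?_
    -- A finite limsup bounds the volumes only eventually, with the slack `+ 1`; individual terms
    -- may be infinite.
    have hA : ∀ᶠ n in atTop, volume (A n) ≤ ∑ j ∈ J, (m j + 1) := by
      have h1 : ∀ᶠ n in atTop, ∀ j ∈ J, volume (E n j) < m j + 1 := by
        rw [Filter.eventually_all_finset]
        intro j hj
        have hjm : m j < ∞ := (Finset.mem_filter.1 hj).2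
        exact eventually_lt_of_limsup_lt
          (by rw [← hm j]; exact ENNReal.lt_add_right hjm.ne one_ne_zero)
      filter_upwards [h1] with n hn
      refine (measure_biUnion_finset_le J _).trans (Finset.sum_le_sum fun j hj => ?_)
      rw [hvol]
      exact (hn j hj).le
    have hM : ∑ j ∈ J, (m j + 1) ≠ ∞ := (ENNReal.sum_lt_top.2 fun j hj =>
      ENNReal.add_lt_top.2 ⟨(Finset.mem_filter.1 hj).2, ENNReal.one_lt_top⟩).ne
    obtain ⟨i, hi⟩ := PartitionCompactness.exists_eventually_volume_diff_balls_le (G := fun n => E' n j)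
      (fun n => hE'm n j)
      (fun n => Set.subset_biUnion_of_mem (u := E' n)
        (show j ∈ J from Finset.mem_filter.2 ⟨Finset.mem_univ j, hj⟩))
      hc hM (hper j hj).ne hA
      (fun n => by
        rw [← PartitionCompactness.perimeter_of_isOpen _ isOpen_univ, hpercongr]
        exact le_iSup (fun n => PartitionCompactness.perimeter (E n j) Set.univ) n) hε
    refine ⟨(Finset.range i).map Function.Embedding.inl, hi.mono fun n hn => ?_⟩
    refine le_of_eq_of_le ?_ hn
    congr 2
    ext z
    simp
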